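/- Let $n\ge 3$, $\frac1{n-1}<u<1$ and $u'=\frac{(n-1)u-1}{n-2}$; then $0<u'<1$. For $m\ge 2$ let $SO(m,1)\subset SL_{m+1}(\mathbb R)$ be the group of matrices of determinant one preserving $-2x_0x_m+x_1^2+\cdots+x_{m-1}^2$, let $P=MAN$ be the stabilizer of the line $\mathbb Re_0$, with $\rho_P(p)=|a|^{(m-1)/2}$ if $pe_0=ae_0$, let $n(x)\in N$ ($x\in\mathbb R^{m-1}$) be the element which fixes $e_0$ and maps $e_i$ to $e_i+x_ie_0$ ($1\le i\le m-1$) and $e_m$ to $\frac{|x|^2}2e_0+\sum_i x_ie_i+e_m$, and let $w\in SO(m,1)$ exchange $e_0$ and $e_m$, map $e_1$ to $-e_1$ and fix the other $e_i$. For real $s$ let $\mathcal F_s$ be the space of continuous functions $f:SO(m,1)\to\mathbb C$ with $f(gp)=\rho_P(p)^{-(1+s)}f(g)$ for all $g\in SO(m,1)$ and $p\in P$; the group acts on it by left translations. For $0<s<1$ put $I_s(f)(g)=\int_{\mathbb R^{m-1}}f(g\,n(x)w)\,dx$ for $f\in\mathcal F_s$, and $\langle f,f'\rangle=\int_{\mathbb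 R^{m-1}}\overline{f(n(x)w)}f'(n(x)w)\,dx$ for $f\in\mathcal F_s$, $f'\in\mathcal F_{-s}$. These integrals converge absolutely, $I_s$ maps $\mathcal F_s$ to $\mathcal F_{-s}$, and (for $(m,s)=(n,u)$ and $(m,s)=(n-1,u')$) $\mathcal F_s$ has a Hilbert space completion with respect to $\langle f,I_s(f')\rangle$, in which the functions that are of Schwartz class on the big cell $x\mapsto n(x)w$ are dense and to which the action on $\mathcal F_s$ extends as a strongly continuous unitary representation: the unramified complementary series. It is denoted by $\widehat\pi_u$ for $G=SO(n,1)$ and by $\widehat\sigma_{u'}$ for $H=SO(n-1,1)$ with parameter $u'$; here $H$ is embedded in $G$ by fixing $e_{n-1}$. Theorem. The representation $\widehat\sigma_{u'}$ occurs discretely in the restriction of $\widehat\pi_u$ to $H$: there is an $H$-equivariant linear isometry $T:\widehat\sigma_{u'}\to\widehat\pi_u$. More precisely: (1) There are constants $a,b>0$ such that $f\mapsto a\,\widehat{f(n(\cdot)w)}$ and $f\mapsto b\,\widehat{f(n(\cdot)w)}$ (Fourier transforms on $\mathbb R^{n-1}$ and $\mathbb R^{n-2}$) extend to isometric isomorphisms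 of $\widehat\pi_u$ onto $L^2(\mathbb R^{n-1},|x|^{-(n-1)u}dx)$ and of $\widehat\sigma_{u'}$ onto $L^2(\mathbb R^{n-2},|y|^{-(n-2)u'}dy)$. (2) Under these isomorphisms $T$ is the map $\phi\mapsto C^{-1/2}J\phi$, where $(J\phi)(y,t)=\phi(y)$ for $(y,t)\in\mathbb R^{n-2}\times\mathbb R$ and $C=\int_{\mathbb R}(1+t^2)^{-(n-1)u/2}dt$. (3) The adjoint $T^*$ of $T$ is, up to a constant, the restriction of functions from $G$ to $H$: restriction maps $\mathcal F_{-u}$ of $G$ into $\mathcal F_{-u'}$ of $H$, and there is a constant $c>0$ such that, if $v\in\widehat\pi_u$ is given by $f'\in\mathcal F_{-u}$ (that is, the inner product of $f$ and $v$ is $\langle f,f'\rangle$ for all $f\in\mathcal F_u$), then $T^*v\in\widehat\sigma_{u'}$ is given in the same way by $c\,f'|_H\in\mathcal F_{-u'}$. The constants $a,b,c$ depend only on $n$ and $u$. -/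

import Mathlib

open MeasureTheory Matrix
open scoped FourierTransform InnerProductSpace ComplexConjugate

namespace UnramifiedRestriction

/-! Throughout, `d` is the dimension of the unipotent radical, so that the group called
`SO d` below is `SO(d + 1, 1)`, acting on `ℝ ^ (d + 2)`. The basis vectors
`e_0, e_1, ..., e_d, e_{d+1}` are indexed by `Fin 2 ⊕ Fin d`: the first one `e_0` is `Sum.inl 0`,
the last one `e_{d+1}` is `Sum.inl 1`, and `e_{i+1}` is `Sum.inr i`. -/

/-- The index set of the coordinates of `ℝ ^ (d + 2)`. -/
abbrev Idx (d : ℕ) : Type := Fin 2 ⊕ Fin d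

/-- The Euclidean space `ℝ ^ d`. -/
abbrev W (d : ℕ) : Type := EuclideanSpace ℝ (Fin d)

/-- The Gram matrix of the quadratic form `- 2 x_0 x_{d+1} + x_1 ^ 2 + ... + x_d ^ 2`,
of signature `(d + 1, 1)`. -/
def gram (d : ℕ) : Matrix (Idx d) (Idx d) ℝ :=
  Matrix.fromBlocks !![0, -1; -1, 0] 0 0 1

/-- The group `SO(d + 1, 1)`: real matrices of determinant one preserving the quadratic form. -/
def SO (d : ℕ) : Subgroup (Matrix.SpecialLinearGroup (Idx d) ℝ) where
  carrier := {g | g.1ᵀ * gram d * g.1 = gram d}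
  mul_mem' := by
    intro a b ha hb
    have ha' : a.1ᵀ * gram d * a.1 = gram d := ha
    have hb' : b.1ᵀ * gram d * b.1 = gram d := hb
    change (a.1 * b.1)ᵀ * gram d * (a.1 * b.1) = gram d
    calc (a.1 * b.1)ᵀ * gram d * (a.1 * b.1)
        = b.1ᵀ * (a.1ᵀ * gram d * a.1) * b.1 := by
          simp only [Matrix.mul_assoc, Matrix.transpose_mul]
      _ = gram d := by rw [ha', hb']
  one_mem' := by
    change (1 : Matrix (Idx d) (Idx d) ℝ)ᵀ * gram d * 1 = gram d
    simp
  inv_mem' := by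
    intro a ha
    have ha' : a.1ᵀ * gram d * a.1 = gram d := ha
    change (a⁻¹).1ᵀ * gram d * (a⁻¹).1 = gram d
    have h1 : a.1 * (a⁻¹).1 = 1 := congrArg Subtype.val (mul_inv_cancel a)
    have h2 : (a⁻¹).1ᵀ * a.1ᵀ = 1 := by
      rw [← Matrix.transpose_mul, h1, Matrix.transpose_one]
    calc (a⁻¹).1ᵀ * gram d * (a⁻¹).1
        = (a⁻¹).1ᵀ * (a.1ᵀ * gram d * a.1) * (a⁻¹).1 := by rw [ha']
      _ = ((a⁻¹).1ᵀ * a.1ᵀ) * gram d * (a.1 * (a⁻¹).1) := by simp only [Matrix.mul_assoc]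
      _ = gram d := by rw [h1, h2, Matrix.one_mul, Matrix.mul_one]

/-- The entry of the matrix `g` in row `i` and column `j`. -/
def entry {d : ℕ} (g : SO d) (i j : Idx d) : ℝ := g.1.1 i j

/-- The parabolic subgroup `P = MAN`: the stabilizer of the line spanned by `e_0`. -/
def P (d : ℕ) : Set (SO d) := {p | ∀ i : Idx d, i ≠ Sum.inl 0 → entry p i (Sum.inl 0) = 0}

/-- The character `ρ_P(man) = |a| ^ (d / 2)` of `P`; an element `p = man` of `P` maps `e_0`
to `± a e_0`. -/
noncomputable def rhoP {d : ℕ} (p : SO d) : ℝ :=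
  |entry p (Sum.inl 0) (Sum.inl 0)| ^ ((d : ℝ) / 2)

/-- The matrix of `n(x)`, `x ∈ ℝ ^ d`: it fixes `e_0`, maps `e_i` to `e_i + x_i e_0` and the last
basis vector `e_{d+1}` to `(|x| ^ 2 / 2) e_0 + x + e_{d+1}`. -/
noncomputable def unipMat {d : ℕ} (x : W d) : Matrix (Idx d) (Idx d) ℝ :=
  Matrix.fromBlocks !![1, (∑ i, x i ^ 2) / 2; 0, 1]
    (Matrix.of fun a i => if a = 0 then x i else 0)
    (Matrix.of fun i a => if a = 1 then x i else 0) 1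

theorem unipMat_det {d : ℕ} (x : W d) : (unipMat x).det = 1 := by
  rw [unipMat, Matrix.det_fromBlocks_one₂₂]
  simp [Matrix.det_fin_two, Matrix.mul_apply]

theorem unipMat_gram {d : ℕ} (x : W d) : (unipMat x)ᵀ * gram d * unipMat x = gram d := by
  rw [unipMat, gram, Matrix.fromBlocks_transpose, Matrix.fromBlocks_multiply,
    Matrix.fromBlocks_multiply]
  congr 1
  · ext i j
    fin_cases i <;> fin_cases j <;>
      simp [Matrix.mul_apply, Fin.sum_univ_two]
    simp only [← pow_two]
    ring
  · ext i j
    fin_cases i <;> simp [Matrix.mul_apply, Fin.sum_univ_two]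
  · ext i j
    fin_cases j <;> simp [Matrix.mul_apply, Fin.sum_univ_two]
  · ext i j
    simp [Matrix.mul_apply]

/-- The parametrization of the unipotent radical `N` of `P` by `ℝ ^ d`. -/
noncomputable def unip {d : ℕ} (x : W d) : SO d :=
  ⟨⟨unipMat x, unipMat_det x⟩, unipMat_gram x⟩

/-- The matrix of `w`: it exchanges the first and the last basis vector, changes the sign of `e_1`
(so that the determinant is one), and fixes the other basis vectors. -/
def weylMat (d : ℕ) [NeZero d] : Matrix (Idx d) (Idx d) ℝ :=
  Matrix.fromBlocks !![0, 1; 1, 0] 0 0 (Matrix.diagonal fun i : Fin d => if i = 0 then -1 else 1)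

theorem weylMat_det (d : ℕ) [NeZero d] : (weylMat d).det = 1 := by
  rw [weylMat, Matrix.det_fromBlocks_zero₂₁, Matrix.det_diagonal]
  simp [Matrix.det_fin_two, Finset.prod_ite_eq']

theorem weylMat_gram (d : ℕ) [NeZero d] : (weylMat d)ᵀ * gram d * weylMat d = gram d := by
  rw [weylMat, gram, Matrix.fromBlocks_transpose, Matrix.fromBlocks_multiply,
    Matrix.fromBlocks_multiply]
  congr 1
  · ext i j
    fin_cases i <;> fin_cases j <;>
      simp [Matrix.mul_apply, Fin.sum_univ_two]
  · simp
  · simp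
  · simp only [Matrix.mul_zero, zero_add, Matrix.diagonal_transpose,
      Matrix.diagonal_mul_diagonal, ← Matrix.diagonal_one]
    congr 1
    ext i
    split_ifs <;> norm_num

/-- The representative `w` of the non-trivial Weyl group element. -/
def weyl (d : ℕ) [NeZero d] : SO d := ⟨⟨weylMat d, weylMat_det d⟩, weylMat_gram d⟩

/-- The index set of `ℝ ^ (d + 3)` is that of `ℝ ^ (d + 2)` together with one more index, which
becomes the index of the last but one basis vector `e_{d+1}` of `ℝ ^ (d + 3)`. -/
def idxEquiv (d : ℕ) : Idx d ⊕ Fin 1 ≃ Idx (d + 1) :=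
  (Equiv.sumAssoc (Fin 2) (Fin d) (Fin 1)).trans
    (Equiv.sumCongr (Equiv.refl (Fin 2)) finSumFinEquiv)

/-- Extension of a matrix by the identity on the last but one basis vector. -/
def embedMat {d : ℕ} (g : Matrix (Idx d) (Idx d) ℝ) : Matrix (Idx (d + 1)) (Idx (d + 1)) ℝ :=
  Matrix.reindex (idxEquiv d) (idxEquiv d) (Matrix.fromBlocks g 0 0 1)

theorem embedMat_mul {d : ℕ} (g h : Matrix (Idx d) (Idx d) ℝ) :
    embedMat (g * h) = embedMat g * embedMat h := by
  simp [embedMat, Matrix.submatrix_mul_equiv, Matrix.fromBlocks_multiply]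

theorem embedMat_one {d : ℕ} : embedMat (1 : Matrix (Idx d) (Idx d) ℝ) = 1 := by
  simp [embedMat]

theorem embedMat_transpose {d : ℕ} (g : Matrix (Idx d) (Idx d) ℝ) :
    embedMat gᵀ = (embedMat g)ᵀ := by
  simp [embedMat, Matrix.fromBlocks_transpose]

theorem embedMat_det {d : ℕ} (g : Matrix (Idx d) (Idx d) ℝ) : (embedMat g).det = g.det := by
  simp [embedMat]

theorem embedMat_gram (d : ℕ) : embedMat (gram d) = gram (d + 1) := by
  ext i j
  obtain ⟨i, rfl⟩ := (idxEquiv d).surjective i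
  obtain ⟨j, rfl⟩ := (idxEquiv d).surjective j
  rcases i with (i | i) | i <;> rcases j with (j | j) | j <;>
    simp [embedMat, gram, idxEquiv, Matrix.one_apply, Fin.ext_iff]
  · exact i.isLt.ne
  · exact j.isLt.ne'

/-- The embedding of `H = SO(d + 1, 1)` into `G = SO(d + 2, 1)` as (part of) the stabilizer of the
last but one basis vector. -/
def embed {d : ℕ} : SO d →* SO (d + 1) where
  toFun g := ⟨⟨embedMat g.1.1, by rw [embedMat_det]; exact g.1.2⟩, by
    have h : g.1.1ᵀ * gram d * g.1.1 = gram d := g.2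
    change (embedMat g.1.1)ᵀ * gram (d + 1) * embedMat g.1.1 = gram (d + 1)
    rw [← embedMat_gram, ← embedMat_transpose, ← embedMat_mul, ← embedMat_mul, h]⟩
  map_one' := by
    apply Subtype.ext
    apply Subtype.ext
    exact embedMat_one
  map_mul' g h := by
    apply Subtype.ext
    apply Subtype.ext
    exact embedMat_mul g.1.1 h.1.1

/-- The space `F_u` of continuous functions `f` on `SO(d + 1, 1)` such that
`f (g p) = ρ_P(p) ^ (-(1 + u)) f (g)` for all `p ∈ P`. -/
noncomputable def F (d : ℕ) (u : ℝ) : Submodule ℂ C(SO d, ℂ) where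
  carrier := {f | ∀ g : SO d, ∀ p ∈ P d, f (g * p) = ((rhoP p ^ (-(1 + u)) : ℝ) : ℂ) * f g}
  add_mem' := by
    intro a b ha hb g p hp
    simp [ha g p hp, hb g p hp, mul_add]
  zero_mem' := by
    intro g p _
    simp
  smul_mem' := by
    intro c a ha g p hp
    simp [ha g p hp, mul_left_comm]

/-- Left translation on `F_u`: `(g f)(x) = f (g⁻¹ x)`. -/
noncomputable def leftTranslate {d : ℕ} {u : ℝ} (g : SO d) : F d u →ₗ[ℂ] F d u where
  toFun f := ⟨f.1.comp ⟨fun x => g⁻¹ * x, continuous_const.mul continuous_id⟩, by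
    intro x p hp
    have h := f.2 (g⁻¹ * x) p hp
    simpa [mul_assoc] using h⟩
  map_add' _ _ := rfl
  map_smul' _ _ := rfl

/-- The restriction of a function on the group to the big Bruhat cell: `x ↦ f (n(x) w)`. -/
noncomputable def bigCell {d : ℕ} [NeZero d] (f : SO d → ℂ) (x : W d) : ℂ := f (unip x * weyl d)

/-- The intertwining integral `I_u(f)(g) = ∫ f (g n(x) w) dx`. -/
noncomputable def intertwine {d : ℕ} [NeZero d] (f : SO d → ℂ) (g : SO d) : ℂ :=
  ∫ x : W d, f (g * unip x * weyl d)

/-- The invariant pairing `⟨f, f'⟩ = ∫ conj (f (n(x) w)) f' (n(x) w) dx` of `F_u` and `F_{-u}`. -/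
noncomputable def pairing {d : ℕ} [NeZero d] (f f' : SO d → ℂ) : ℂ :=
  ∫ x : W d, conj (bigCell f x) * bigCell f' x

/-- The integrals defining `I_u` on `F_u` converge absolutely, `I_u` maps `F_u` to `F_{-u}`, and
the integrals defining the pairing of `F_u` and `F_{-u}` converge absolutely. -/
def IntegralsConverge (d : ℕ) [NeZero d] (u : ℝ) : Prop :=
  (∀ f : F d u, ∀ g : SO d, Integrable fun x : W d => f.1 (g * unip x * weyl d)) ∧
  (∀ f : F d u, ∃ f' : F d (-u), ∀ g : SO d, f'.1 g = intertwine f.1 g) ∧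
  (∀ (f : F d u) (f' : F d (-u)), Integrable fun x : W d => conj (bigCell f.1 x) * bigCell f'.1 x)

/-- `(E, π, ι)` is the unramified complementary series of `SO(d + 1, 1)` with parameter `u`: the
Hilbert space `E` is the completion, through `ι`, of `F_u` with respect to the inner product
`⟨f, I_u f'⟩` (the functions that are of Schwartz class on the big Bruhat cell being already
dense), and `π` is the (strongly continuous) unitary representation which extends the action of
the group on `F_u` by left translations. These properties determine `(E, π, ι)` up to a unique
isomorphism. -/
structure IsComplementarySeries {d : ℕ} [NeZero d] {u : ℝ} {E : Type*} [NormedAddCommGroup E]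
    [InnerProductSpace ℂ E] [CompleteSpace E]
    (π : SO d →* (E ≃ₗᵢ[ℂ] E)) (ι : F d u →ₗ[ℂ] E) : Prop where
  inner_eq : ∀ f f' : F d u, ⟪ι f, ι f'⟫_ℂ = pairing f.1 (intertwine f'.1)
  dense : Dense (ι '' {f | ∃ s : SchwartzMap (W d) ℂ, ∀ x, bigCell f.1 x = s x})
  map_translate : ∀ (g : SO d) (f : F d u), π g (ι f) = ι (leftTranslate g f)
  continuous : ∀ v : E, Continuous fun g => π g v

/-- The vector `v` of the completion `E` of `F_u` is given by the function `f'` in `F_{-u}`: the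
functional that `v` defines on `F_u` is the pairing with `f'`. By the definition of the inner
product, the image of `f ∈ F_u` in `E` is given by the function `I_u(f)`. -/
def Represents {d : ℕ} [NeZero d] {u : ℝ} {E : Type*} [NormedAddCommGroup E]
    [InnerProductSpace ℂ E] (ι : F d u →ₗ[ℂ] E) (v : E) (f' : F d (-u)) : Prop :=
  ∀ f : F d u, ⟪ι f, v⟫_ℂ = pairing f.1 f'.1

/-- The measure `|x| ^ (-d u) dx` on `ℝ ^ d`. -/
noncomputable def weight (d : ℕ) (u : ℝ) : Measure (W d) :=
  volume.withDensity fun x => ENNReal.ofReal (‖x‖ ^ (-((d : ℝ) * u)))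

/-- The Hilbert space `L ^ 2 (ℝ ^ d, |x| ^ (-d u) dx)`. -/
abbrev WHat (d : ℕ) (u : ℝ) : Type := Lp ℂ 2 (weight d u)

/-- The projection `ℝ ^ (d + 1) → ℝ ^ d` which forgets the last coordinate. -/
def forgetLast {d : ℕ} (x : W (d + 1)) : W d := WithLp.toLp 2 fun i => x i.castSucc

end UnramifiedRestriction

/-! A function in `F d u` depends only on the vector `g e_0` of the light cone, and is even and
homogeneous of degree `-d(1+u)/2` there; it is determined by its restriction to the big cell, a
function on `ℝ^d`. On the big cell `w` acts as an inversion, and the corresponding substitution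
turns `I_u` into convolution with a multiple of the Riesz kernel `|x|^(-d(1-u))`
(`intertwine_unip_weyl`). The Fourier transform diagonalizes this convolution, with multiplier a
positive multiple of `|ξ|^(-du)` (`riesz_eq_fourier`). Hence `⟨f, I_u f'⟩` is, up to a positive
constant, the inner product of Fourier transforms in `L²(|ξ|^(-du) dξ)` (`inner_fourierLp`), and
this weighted space is a model of the complementary series.

In these models the isometry comes from one integral: with `d = n - 2`, the integral of
`(|y|²+t²)^(-(d+1)u/2)` over `t` is `C |y|^(1-(d+1)u) = C |y|^(-du')`, which converges because
`(d+1)u > 1`. So extending functions of `y` constantly in `t` multiplies norms by `√C`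
(`lintegral_comp_forgetLast`, `exists_extension_isometry`).

Equivariance cannot be seen on the Fourier side, where only the parabolic acts simply; it comes from
the adjoint. A function on the Fourier side that is constant in `t` corresponds to `φ(y) δ(t)` on
the big cell, and pairing this distribution with a function in `F_{-u}` restricts the function to `t
= 0`, that is, to `H`. Restriction respects the homogeneity since `(d+1)(1-u) = d(1-u')`
(`exists_restriction`), and it obviously commutes with `H`. As `φ(y) δ(t)` is not in `F_u`, it is
approximated by `φ(y) kβ(kt)` (`exists_thickening`), which proves the adjoint formula
(`inner_extension`). Invariance of the pairings then gives equivariance (`equivariant_of_inner_eq`).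
-/

namespace UnramifiedRestriction

/-! ### The light cone, homogeneous functions and the action on the big cell -/

section Group

variable {d : ℕ}

/-- The image `g e_0` of the first basis vector. -/
def col (g : SO d) : Idx d → ℝ := fun i => entry g i (Sum.inl 0)

/-- The vector `(|x| ^ 2 / 2, x, 1)` of the light cone. -/
noncomputable def coneVec (x : W d) : Idx d → ℝ := Sum.elim ![‖x‖ ^ 2 / 2, 1] x

@[simp] theorem coneVec_zero (x : W d) : coneVec x (Sum.inl 0) = ‖x‖ ^ 2 / 2 := rfl
@[simp] theorem coneVec_last (x : W d) : coneVec x (Sum.inl 1) = 1 := rfl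
@[simp] theorem coneVec_mid (x : W d) (i : Fin d) : coneVec x (Sum.inr i) = x i := rfl

theorem col_mul (g h : SO d) : col (g * h) = g.1.1 *ᵥ col h := by
  ext i
  simp [col, entry, Matrix.mulVec, Matrix.mul_apply, dotProduct]

theorem idx_sum (f : Idx d → ℝ) :
    ∑ i, f i = f (Sum.inl 0) + f (Sum.inl 1) + ∑ k, f (Sum.inr k) := by
  simp [Fintype.sum_sum_type, Fin.sum_univ_two]

theorem col_one : col (1 : SO d) = Pi.single (Sum.inl 0) 1 := by
  ext i
  simp [col, entry, Matrix.one_apply, Pi.single_apply]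

theorem mul_mulVec_single (g : SO d) : g.1.1 *ᵥ (Pi.single (Sum.inl 0) 1) = col g := by
  ext i
  simp [col, entry]

theorem inv_mulVec (g : SO d) (v : Idx d → ℝ) : (g⁻¹).1.1 *ᵥ (g.1.1 *ᵥ v) = v := by
  have h : (g⁻¹).1.1 * g.1.1 = 1 :=
    congrArg (fun k : SO d => k.1.1) (inv_mul_cancel g)
  rw [Matrix.mulVec_mulVec, h, Matrix.one_mulVec]

theorem gram_columns (g : SO d) (i j : Idx d) :
    -(entry g (Sum.inl 0) i * entry g (Sum.inl 1) j) -
      entry g (Sum.inl 1) i * entry g (Sum.inl 0) j +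
      ∑ k, entry g (Sum.inr k) i * entry g (Sum.inr k) j = gram d i j := by
  have h : (g.1.1)ᵀ * gram d * g.1.1 = gram d := g.2
  rw [← congrFun (congrFun h i) j]
  simp only [Matrix.mul_apply, idx_sum, Matrix.transpose_apply, entry]
  simp [gram, Matrix.one_apply]
  ring

theorem col_isotropic (g : SO d) :
    2 * col g (Sum.inl 0) * col g (Sum.inl 1) = ∑ k, col g (Sum.inr k) ^ 2 := by
  have h := gram_columns g (Sum.inl 0) (Sum.inl 0)
  simp only [gram, Matrix.fromBlocks_apply₁₁, Matrix.of_apply, Matrix.cons_val_zero] at h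
  simp only [col, sq]
  linarith

theorem col_ne_zero (g : SO d) : col g ≠ 0 := by
  intro h
  have h1 := inv_mulVec g (Pi.single (Sum.inl 0) 1)
  rw [mul_mulVec_single, h, Matrix.mulVec_zero] at h1
  simpa using congrFun h1 (Sum.inl 0)

theorem mem_P_iff_col {p : SO d} : p ∈ P d ↔ col p = entry p (Sum.inl 0) (Sum.inl 0) • col 1 := by
  rw [col_one]
  constructor
  · intro h
    ext i
    by_cases hi : i = Sum.inl 0
    · subst hi; simp [col]
    · simp [col, h i hi, hi]
  · intro h i hi
    simpa [col, Pi.single_apply, hi] using congrFun h i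

theorem mem_P_of_col {p : SO d} {c : ℝ} (h : col p = c • col 1) :
    p ∈ P d ∧ entry p (Sum.inl 0) (Sum.inl 0) = c := by
  have h0 : entry p (Sum.inl 0) (Sum.inl 0) = c := by
    simpa [col_one, col] using congrFun h (Sum.inl 0)
  exact ⟨mem_P_iff_col.2 (by rw [h0, h]), h0⟩

theorem col_inv_mul {g g' : SO d} {c : ℝ} (h : col g = c • col g') :
    col (g'⁻¹ * g) = c • col 1 := by
  rw [col_mul, h, Matrix.mulVec_smul, ← mul_mulVec_single g', inv_mulVec, col_one]

theorem col_smul_mul {g g' : SO d} {c : ℝ} (h : col g = c • col g') (k : SO d) :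
    col (k * g) = c • col (k * g') := by
  rw [col_mul, h, Matrix.mulVec_smul, col_mul]

/-- Functions on the group that come from even homogeneous functions of degree `-t` on the
light cone. -/
def Homog (t : ℝ) (f : SO d → ℂ) : Prop :=
  ∀ (g g' : SO d) (c : ℝ), col g = c • col g' → f g = ((|c| ^ (-t) : ℝ) : ℂ) * f g'

theorem smul_ne_zero_of_col {g g' : SO d} {c : ℝ} (h : col g = c • col g') : c ≠ 0 := by
  rintro rfl
  exact col_ne_zero g (by simpa using h)

theorem Homog.mul {t t' : ℝ} {f f' : SO d → ℂ} (hf : Homog t f) (hf' : Homog t' f') :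
    Homog (t + t') fun g => f g * f' g := by
  intro g g' c h
  have hc : 0 < |c| := abs_pos.2 (smul_ne_zero_of_col h)
  simp only [hf g g' c h, hf' g g' c h, neg_add, Real.rpow_add hc]
  push_cast
  ring

theorem Homog.conj {t : ℝ} {f : SO d → ℂ} (hf : Homog t f) : Homog t fun g => conj (f g) := by
  intro g g' c h
  simp only [hf g g' c h, map_mul, Complex.conj_ofReal]

theorem Homog.comp_mul_left {t : ℝ} {f : SO d → ℂ} (hf : Homog t f) (k : SO d) :
    Homog t fun g => f (k * g) :=
  fun _ _ c h => hf _ _ c (col_smul_mul h k)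

theorem rhoP_rpow (p : SO d) (s : ℝ) : rhoP p ^ s =
    |entry p (Sum.inl 0) (Sum.inl 0)| ^ ((d : ℝ) / 2 * s) := by
  rw [rhoP, Real.rpow_mul (abs_nonneg _)]

/-- If `g e_0 = c g' e_0`, then `g'⁻¹ g` lies in `P` and multiplies `e_0` by `c`, so covariance
under `P` is the same as even homogeneity on the light cone. From here on elements of the group are
compared only through their first columns, which avoids matrix decompositions. -/
theorem homog_of_mem {u : ℝ} (f : F d u) : Homog ((d : ℝ) * (1 + u) / 2) f.1 := by
  intro g g' c h
  obtain ⟨hp, h0⟩ := mem_P_of_col (col_inv_mul h)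
  have h1 := f.2 g' (g'⁻¹ * g) hp
  rw [mul_inv_cancel_left, rhoP_rpow, h0] at h1
  rw [h1]
  congr 4
  ring

theorem mem_F_of_homog {u : ℝ} (f : C(SO d, ℂ)) (hf : Homog ((d : ℝ) * (1 + u) / 2) f) :
    f ∈ F d u := by
  intro g p hp
  have h := hf (g * p) g _ (by
    have := col_smul_mul (mem_P_iff_col.1 hp) g
    rwa [mul_one] at this)
  rw [h, rhoP_rpow]
  congr 4
  ring

theorem sum_sq_eq_norm (x : W d) : ∑ i, x i ^ 2 = ‖x‖ ^ 2 := by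
  rw [EuclideanSpace.norm_sq_eq]
  simp

theorem unip_mulVec_coneVec (x y : W d) : (unip x).1.1 *ᵥ coneVec y = coneVec (x + y) := by
  ext i
  change (unipMat x *ᵥ coneVec y) i = _
  simp only [Matrix.mulVec, dotProduct, idx_sum]
  rcases i with i | i
  · fin_cases i
    · simp [unipMat, ← sum_sq_eq_norm, add_sq, Finset.sum_add_distrib, mul_assoc,
        ← Finset.mul_sum]
      ring
    · simp [unipMat]
  · simp [unipMat, Matrix.one_apply]

theorem weyl_mulVec_coneVec [NeZero d] (v : Idx d → ℝ) : (weyl d).1.1 *ᵥ v =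
    Sum.elim ![v (Sum.inl 1), v (Sum.inl 0)]
      fun i => if i = 0 then - v (Sum.inr i) else v (Sum.inr i) := by
  ext i
  change (weylMat d *ᵥ v) i = _
  simp only [Matrix.mulVec, dotProduct, idx_sum]
  rcases i with i | i
  · fin_cases i <;> simp [weylMat]
  · simp [weylMat, Matrix.diagonal_apply]

theorem col_weyl [NeZero d] : col (weyl d) = coneVec 0 := by
  rw [← mul_mulVec_single, weyl_mulVec_coneVec]
  ext i
  rcases i with i | i
  · fin_cases i <;> simp
  · simp

theorem col_unip_weyl [NeZero d] (x : W d) : col (unip x * weyl d) = coneVec x := by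
  rw [col_mul, col_weyl, unip_mulVec_coneVec, add_zero]

theorem col_unip (x : W d) : col (unip x) = (1 : ℝ) • col (1 : SO d) := by
  rw [col_one, one_smul]
  ext i
  change unipMat x i (Sum.inl 0) = _
  rcases i with i | i
  · fin_cases i <;> simp [unipMat]
  · simp [unipMat]

/-- The action of `w` on the middle coordinates. -/
noncomputable def flip (d : ℕ) [NeZero d] : W d ≃ₗᵢ[ℝ] W d :=
  LinearIsometryEquiv.piLpCongrRight 2 fun i : Fin d =>
    if i = 0 then LinearIsometryEquiv.neg ℝ else LinearIsometryEquiv.refl ℝ ℝ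

theorem flip_apply [NeZero d] (x : W d) (i : Fin d) :
    flip d x i = if i = 0 then - x i else x i := by
  simp only [flip, LinearIsometryEquiv.piLpCongrRight_apply]
  split_ifs <;> rfl

/-- Since `w` exchanges the outer coordinates of `(|x|²/2, x, 1)`, it acts on the big cell as the
inversion in the sphere of radius `√2` followed by a reflection. The automorphy factor is `|x|²/2`.
-/
theorem col_weyl_unip_weyl [NeZero d] {x : W d} (hx : x ≠ 0) :
    col (weyl d * (unip x * weyl d)) =
      (‖x‖ ^ 2 / 2) • col (unip ((2 / ‖x‖ ^ 2) • flip d x) * weyl d) := by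
  have hx' : ‖x‖ ≠ 0 := norm_ne_zero_iff.2 hx
  rw [col_mul, col_unip_weyl, col_unip_weyl, weyl_mulVec_coneVec]
  ext i
  rcases i with i | i
  · fin_cases i
    · simp [norm_smul]
      field_simp
    · simp
  · simp [flip_apply]
    split_ifs <;> field_simp

/-- The Bruhat decomposition. -/
theorem col_bruhat [NeZero d] (g : SO d) :
    (∃ c : ℝ, col g = c • col 1) ∨ ∃ (c : ℝ) (x : W d), col g = c • col (unip x * weyl d) := by
  have hiso := col_isotropic g
  by_cases h : col g (Sum.inl 1) = 0
  · left
    refine ⟨col g (Sum.inl 0), ?_⟩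
    -- An isotropic vector with last coordinate zero has zero middle part, so it is a multiple of
    -- `e_0`.
    rw [h, mul_zero, eq_comm, Finset.sum_eq_zero_iff_of_nonneg (fun _ _ => sq_nonneg _)] at hiso
    rw [col_one]
    ext i
    rcases i with i | i
    · fin_cases i
      · simp
      · simp [h]
    · simpa using hiso i (Finset.mem_univ _)
  · right
    refine ⟨col g (Sum.inl 1),
      WithLp.toLp 2 fun i => (col g (Sum.inl 1))⁻¹ * col g (Sum.inr i), ?_⟩
    rw [col_unip_weyl]
    ext i
    rcases i with i | i
    · fin_cases i
      · simp only [Fin.zero_eta, Pi.smul_apply, coneVec_zero, smul_eq_mul, ← sum_sq_eq_norm,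
          mul_pow, ← Finset.mul_sum, ← hiso]
        field_simp
      · simp
    · simp [h]

/-- `P` acts on the big cell by similarities. Orthogonality of the other columns of `p` to `a e_0`
forces the last row to be `(0, ..., 0, a⁻¹)`; the middle block is then orthogonal and gives `L`,
while the last column gives the translation. -/
theorem P_mulVec [NeZero d] {p : SO d} {a : ℝ} (hp : col p = a • col 1) :
    ∃ (L : W d ≃ₗᵢ[ℝ] W d) (c : W d), ∀ x : W d,
      col (p * (unip x * weyl d)) = a⁻¹ • col (unip (a • L x + c) * weyl d) := by
  have ha : a ≠ 0 := smul_ne_zero_of_col hp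
  have hcol : ∀ i, entry p i (Sum.inl 0) = if i = Sum.inl 0 then a else 0 := by
    intro i
    have := congrFun hp i
    rw [col_one] at this
    simpa [col, Pi.single_apply] using this
  have hlast : ∀ j, -(a * entry p (Sum.inl 1) j) = gram d (Sum.inl 0) j := by
    intro j
    have := gram_columns p (Sum.inl 0) j
    simpa [hcol] using this
  have hll : entry p (Sum.inl 1) (Sum.inl 1) = a⁻¹ := by
    have := hlast (Sum.inl 1)
    simp [gram] at this
    field_simp
    linarith
  have hlm : ∀ j, entry p (Sum.inl 1) (Sum.inr j) = 0 := by
    intro j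
    have := hlast (Sum.inr j)
    simpa [gram, ha] using this
  have horth : ∀ i j, ∑ k, entry p (Sum.inr k) (Sum.inr i) * entry p (Sum.inr k) (Sum.inr j) =
      if i = j then 1 else 0 := by
    intro i j
    have := gram_columns p (Sum.inr i) (Sum.inr j)
    simpa [hlm, gram, Matrix.one_apply] using this
  let M : Matrix (Fin d) (Fin d) ℝ := Matrix.of fun i j => entry p (Sum.inr i) (Sum.inr j)
  have hM : Mᵀ * M = 1 := by
    ext i j
    simpa [M, Matrix.mul_apply, Matrix.one_apply] using horth i j
  have hnorm : ∀ x : W d, ‖Matrix.toEuclideanLin M x‖ = ‖x‖ := by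
    intro x
    rw [← sq_eq_sq₀ (norm_nonneg _) (norm_nonneg _), ← sum_sq_eq_norm, ← sum_sq_eq_norm]
    have h1 : (M *ᵥ x) ⬝ᵥ (M *ᵥ x) = x ⬝ᵥ x := by
      rw [Matrix.dotProduct_mulVec, ← Matrix.mulVec_transpose, Matrix.mulVec_mulVec, hM,
        Matrix.one_mulVec]
    simpa [dotProduct, sq, Matrix.toLpLin_apply] using h1
  let L0 : W d →ₗᵢ[ℝ] W d := ⟨Matrix.toEuclideanLin M, hnorm⟩
  refine ⟨L0.toLinearIsometryEquiv rfl,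
    WithLp.toLp 2 fun i => a * entry p (Sum.inr i) (Sum.inl 1), fun x => ?_⟩
  set y := a • L0.toLinearIsometryEquiv rfl x +
    WithLp.toLp 2 fun i => a * entry p (Sum.inr i) (Sum.inl 1) with hy
  have hentry : ∀ i, col (p * (unip x * weyl d)) i = entry p i (Sum.inl 0) * (‖x‖ ^ 2 / 2) +
      entry p i (Sum.inl 1) + ∑ k, entry p i (Sum.inr k) * x k := by
    intro i
    rw [col_mul, col_unip_weyl]
    simp [Matrix.mulVec, dotProduct, entry]
  have h1 : col (p * (unip x * weyl d)) (Sum.inl 1) = a⁻¹ := by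
    rw [hentry]; simp [hcol, hll, hlm]
  have hmid : ∀ k, col (p * (unip x * weyl d)) (Sum.inr k) = a⁻¹ * y k := by
    intro k
    rw [hentry]
    simp [hcol, hy, L0, M, Matrix.toLpLin_apply, Matrix.mulVec, dotProduct]
    field_simp
    ring
  -- The coordinate along `e_0` needs no computation: isotropy determines it from the others, the
  -- last one being nonzero.
  have hiso := col_isotropic (p * (unip x * weyl d))
  rw [h1] at hiso
  simp only [hmid, mul_pow, ← Finset.mul_sum, sum_sq_eq_norm] at hiso
  rw [col_unip_weyl]
  ext i
  rcases i with i | i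
  · fin_cases i
    · simp only [Fin.zero_eta, Pi.smul_apply, coneVec_zero, smul_eq_mul]
      field_simp at hiso ⊢
      linarith
    · simpa using h1
  · simpa using hmid i

theorem embed_entry_inl (g : SO d) (i j : Idx d) :
    entry (embed g) (idxEquiv d (Sum.inl i)) (idxEquiv d (Sum.inl j)) = entry g i j := by
  change embedMat g.1.1 _ _ = g.1.1 i j
  simp [embedMat]

theorem embed_entry_inr (g : SO d) (i : Fin 1) (j : Idx d) :
    entry (embed g) (idxEquiv d (Sum.inr i)) (idxEquiv d (Sum.inl j)) = 0 := by
  change embedMat g.1.1 _ _ = 0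
  simp [embedMat]

theorem idxEquiv_zero : idxEquiv d (Sum.inl (Sum.inl 0)) = Sum.inl 0 := rfl

theorem col_embed_smul {g g' : SO d} {c : ℝ} (h : col g = c • col g') :
    col (embed g) = c • col (embed g') := by
  ext i
  obtain ⟨i, rfl⟩ := (idxEquiv d).surjective i
  rcases i with i | i
  · have := congrFun h i
    simpa only [col, Pi.smul_apply, ← idxEquiv_zero, embed_entry_inl] using this
  · simp only [col, Pi.smul_apply, ← idxEquiv_zero, embed_entry_inr, smul_zero]

/-- The point `(y, t)` of `ℝ ^ (d + 1) = ℝ ^ d × ℝ`. -/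
def snocPt (y : W d) (t : ℝ) : W (d + 1) := WithLp.toLp 2 (Fin.snoc (y : Fin d → ℝ) t)

theorem norm_snocPt_sq (y : W d) (t : ℝ) : ‖snocPt y t‖ ^ 2 = ‖y‖ ^ 2 + t ^ 2 := by
  rw [← sum_sq_eq_norm, ← sum_sq_eq_norm, Fin.sum_univ_castSucc]
  simp [snocPt]

/-- The big cell of `H` is the hyperplane `t = 0` in that of `G`. Equality of first columns
suffices, because functions in `F` see nothing else. -/
theorem col_embed_unip_weyl [NeZero d] (y : W d) :
    col (embed (unip y * weyl d)) = (1 : ℝ) • col (unip (snocPt y 0) * weyl (d + 1)) := by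
  rw [col_unip_weyl, one_smul]
  ext i
  obtain ⟨i, rfl⟩ := (idxEquiv d).surjective i
  rcases i with i | i
  · have h := congrFun (col_unip_weyl y) i
    simp only [col, ← idxEquiv_zero, embed_entry_inl] at h ⊢
    rw [h]
    rcases i with i | i
    · fin_cases i
      · simp [idxEquiv, norm_snocPt_sq]
      · simp [idxEquiv]
    · simp only [idxEquiv, snocPt, Equiv.trans_apply]
      exact (Fin.snoc_castSucc (α := fun _ => ℝ) 0 y.ofLp i).symm
  · simp only [col, ← idxEquiv_zero, embed_entry_inr]
    fin_cases i
    simp only [idxEquiv, snocPt, Equiv.trans_apply]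
    exact (Fin.snoc_last (α := fun _ => ℝ) 0 y.ofLp).symm

end Group

/-! ### Changes of variables on the big cell, invariance of the pairing, and the Riesz kernel -/

section ChangeOfVariables

variable {d : ℕ}

/-- The derivative of the inversion in the sphere of radius `√2` is `2/|x|²` times a reflection, so
its Jacobian is `(2/|x|²)^d`. The origin, where it is not differentiable, is a null set. -/
theorem integral_comp_inversion [NeZero d] (h : W d → ℂ) :
    ∫ x : W d, (((2 / ‖x‖ ^ 2) ^ d : ℝ) : ℂ) * h ((2 / ‖x‖ ^ 2) • flip d x) = ∫ x, h x := by
  have hne : Nontrivial (W d) := inferInstance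
  have hsq : (√2 : ℝ) ≠ 0 := by positivity
  let f : W d → W d := EuclideanGeometry.inversion 0 √2
  have hf : ∀ x, f x = (2 / ‖x‖ ^ 2) • x := by
    intro x
    simp [f, EuclideanGeometry.inversion, div_pow]
  have himage : f '' {0}ᶜ = {0}ᶜ := by
    ext y
    constructor
    · rintro ⟨x, hx, rfl⟩
      simpa [f, EuclideanGeometry.inversion_eq_center hsq] using hx
    · intro hy
      refine ⟨f y, ?_, EuclideanGeometry.inversion_inversion _ hsq y⟩
      simpa [f, EuclideanGeometry.inversion_eq_center hsq] using hy
  have hres : ∀ k : W d → ℂ, ∫ x in ({0}ᶜ : Set (W d)), k x = ∫ x, k x := fun k => by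
    rw [restrict_compl_singleton]
  have key := integral_image_eq_integral_abs_det_fderiv_smul (volume : Measure (W d))
    (s := {0}ᶜ) (measurableSet_singleton 0).compl (f := f)
    (fun x hx => (EuclideanGeometry.hasFDerivAt_inversion (R := √2) (c := (0 : W d))
      hx).hasFDerivWithinAt)
    ((EuclideanGeometry.inversion_injective 0 hsq).injOn) (fun x => h (flip d x))
  rw [himage, hres, hres] at key
  have hflip : ∫ x : W d, h (flip d x) = ∫ x, h x :=
    (flip d).measurePreserving.integral_comp (flip d).toHomeomorph.measurableEmbedding h
  rw [← hflip, key]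
  congr 1
  ext x
  rw [hf, map_smul, Complex.real_smul]
  congr 2
  rw [ContinuousLinearMap.det]
  simp only [ContinuousLinearMap.toLinearMap_smul, LinearMap.det_smul, finrank_euclideanSpace,
    Fintype.card_fin, dist_zero_right, div_pow, abs_mul]
  have hdet : |LinearMap.det ((((ℝ ∙ (x - 0))ᗮ.reflection : W d →L[ℝ] W d) : W d →ₗ[ℝ] W d))| =
      1 := by
    have := Submodule.det_reflection (𝕜 := ℝ) (ℝ ∙ (x - 0))ᗮ
    erw [this]
    simp
  rw [hdet, mul_one, abs_of_nonneg (by positivity)]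
  simp

/-- The similarity of ratio `a` contributes `|a|^(-d)` and homogeneity contributes `|a|^t`. These
cancel in the critical degree `t = d`. -/
theorem integral_mul_P [NeZero d] {t : ℝ} {f : SO d → ℂ} (hf : Homog t f) {p : SO d} {a : ℝ}
    (hp : col p = a • col 1) :
    ∫ x : W d, f (p * (unip x * weyl d)) = ((|a| ^ (t - d) : ℝ) : ℂ) * ∫ x, bigCell f x := by
  obtain ⟨L, c, hL⟩ := P_mulVec hp
  have ha : 0 < |a| := abs_pos.2 (smul_ne_zero_of_col hp)
  have h1 : ∀ x : W d, f (p * (unip x * weyl d)) =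
      ((|a| ^ t : ℝ) : ℂ) * bigCell f (a • L x + c) := by
    intro x
    rw [hf _ _ _ (hL x), abs_inv, Real.inv_rpow ha.le, Real.rpow_neg ha.le, inv_inv]
    rfl
  have h2 : ∫ x : W d, bigCell f (a • L x + c) = ∫ x : W d, bigCell f (a • x + c) :=
    L.measurePreserving.integral_comp L.toHomeomorph.measurableEmbedding
      (fun x => bigCell f (a • x + c))
  have h3 := Measure.integral_comp_smul (volume : Measure (W d)) (fun x => bigCell f (x + c)) a
  rw [integral_add_right_eq_self] at h3
  simp_rw [h1]
  rw [integral_const_mul, h2, h3, finrank_euclideanSpace, Fintype.card_fin, Complex.real_smul,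
    ← mul_assoc, ← Complex.ofReal_mul, Real.rpow_sub ha, Real.rpow_natCast, abs_inv, abs_pow]
  rfl

theorem apply_weyl_mul [NeZero d] {t : ℝ} {f : SO d → ℂ} (hf : Homog t f) {x : W d} (hx : x ≠ 0) :
    f (weyl d * (unip x * weyl d)) =
      (((2 / ‖x‖ ^ 2) ^ t : ℝ) : ℂ) * bigCell f ((2 / ‖x‖ ^ 2) • flip d x) := by
  have hx' : 0 < ‖x‖ := norm_pos_iff.2 hx
  rw [hf _ _ _ (col_weyl_unip_weyl hx), abs_of_pos (by positivity),
    Real.rpow_neg (by positivity), ← Real.inv_rpow (by positivity), inv_div]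
  rfl

theorem ae_ne_zero [NeZero d] : ∀ᵐ x : W d, x ≠ 0 := by
  have hne : Nontrivial (W d) := inferInstance
  simp [ae_iff]

theorem integral_mul_weyl [NeZero d] {t : ℝ} {f : SO d → ℂ} (hf : Homog t f) :
    ∫ x : W d, f (weyl d * (unip x * weyl d)) =
      ∫ x : W d, (((‖x‖ ^ 2 / 2) ^ (t - d) : ℝ) : ℂ) * bigCell f x := by
  rw [← integral_comp_inversion fun x =>
    (((‖x‖ ^ 2 / 2) ^ (t - d) : ℝ) : ℂ) * bigCell f x]
  apply integral_congr_ae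
  filter_upwards [ae_ne_zero] with x hx
  have hx' : 0 < ‖x‖ := norm_pos_iff.2 hx
  have hn : ‖(2 / ‖x‖ ^ 2) • flip d x‖ ^ 2 / 2 = 2 / ‖x‖ ^ 2 := by
    simp [norm_smul]
    field_simp
  rw [apply_weyl_mul hf hx, hn, ← mul_assoc, ← Complex.ofReal_mul, ← Real.rpow_natCast _ d,
    ← Real.rpow_add (by positivity), add_sub_cancel]

/-- The integral over the big cell is invariant under left translations in the
critical degree. -/
theorem integral_mul_left [NeZero d] {f : SO d → ℂ} (hf : Homog d f) (g : SO d) :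
    ∫ x : W d, f (g * (unip x * weyl d)) = ∫ x, bigCell f x := by
  have hP : ∀ {f : SO d → ℂ} (hf : Homog d f) {p : SO d} {a : ℝ} (hp : col p = a • col 1),
      ∫ x : W d, f (p * (unip x * weyl d)) = ∫ x, bigCell f x := by
    intro f hf p a hp
    simpa using integral_mul_P hf hp
  rcases col_bruhat g with ⟨c, hc⟩ | ⟨c, y, hc⟩
  · exact hP hf hc
  · have hp := col_inv_mul hc
    set p := (unip y * weyl d)⁻¹ * g with hpdef
    -- Off `P` itself, `g = n(y) w p`, so invariance follows from invariance under the three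
    -- factors.
    have hg : g = unip y * (weyl d * p) := by rw [hpdef]; group
    have h1 := hP ((hf.comp_mul_left (unip y)).comp_mul_left (weyl d)) hp
    have h2 := integral_mul_weyl (hf.comp_mul_left (unip y))
    have h3 := hP hf (col_unip y)
    simp only [sub_self, Real.rpow_zero, Complex.ofReal_one, one_mul] at h2
    simp only [bigCell] at h1 h2 h3 ⊢
    rw [← h3, ← h2, ← h1, hg]
    simp only [mul_assoc]

/-- The degrees `d(1+u)/2` and `d(1-u)/2` add up to the critical degree `d`. -/
theorem pairing_mul_left [NeZero d] {u : ℝ} (f : F d u) (f' : F d (-u)) (g : SO d) :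
    pairing (fun x => f.1 (g * x)) (fun x => f'.1 (g * x)) = pairing f.1 f'.1 := by
  have h := (homog_of_mem f).conj.mul (homog_of_mem f')
  have ht : (d : ℝ) * (1 + u) / 2 + d * (1 + -u) / 2 = d := by ring
  rw [ht] at h
  exact integral_mul_left h g

/-- The integrand is a left translate by `w` of a function of degree `t = d(1+u)/2`. Inverting the
variable leaves the factor `(|x|²/2)^(t-d)`, which is the Riesz kernel `|x|^(-d(1-u))` up to a power
of 2. -/
theorem intertwine_unip_weyl [NeZero d] {u : ℝ} (f : F d u) (y : W d) :
    intertwine f.1 (unip y * weyl d) = ((2 ^ ((d : ℝ) * (1 - u) / 2) : ℝ) : ℂ) *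
      ∫ x : W d, ((‖x‖ ^ (-((d : ℝ) * (1 - u))) : ℝ) : ℂ) * bigCell f.1 (y + x) := by
  have h := integral_mul_weyl ((homog_of_mem f).comp_mul_left (unip y))
  rw [intertwine]
  simp only [← mul_assoc] at h
  rw [h, ← integral_const_mul]
  congr 1
  ext x
  have h1 : bigCell (fun g => f.1 (unip y * g)) x = bigCell f.1 (y + x) := by
    simp only [bigCell]
    rw [homog_of_mem f (unip y * (unip x * weyl d)) (unip (y + x) * weyl d) 1]
    · simp
    · rw [col_mul, col_unip_weyl, unip_mulVec_coneVec, col_unip_weyl, one_smul]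
  rw [h1, ← mul_assoc, ← Complex.ofReal_mul]
  congr 2
  rw [Real.div_rpow (by positivity) (by positivity), ← Real.rpow_natCast, ← Real.rpow_mul
    (norm_nonneg _), div_eq_mul_inv, ← Real.rpow_neg (by positivity), mul_comm]
  congr 2 <;> push_cast <;> ring

end ChangeOfVariables

/-! ### Decay on the big cell, convergence of the integrals, continuity -/

section Bounds

open Filter Topology

theorem _root_.IsCompact.exists_eventually_norm_le {X Y E : Type*} [TopologicalSpace X]
    [TopologicalSpace Y] [SeminormedAddCommGroup E] {K : Set Y} (hK : IsCompact K) {f : X → Y → E}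
    (hf : Continuous (Function.uncurry f)) (x₀ : X) :
    ∃ C : ℝ, ∀ᶠ x in 𝓝 x₀, ∀ y ∈ K, ‖f x y‖ ≤ C := by
  have h0 : Continuous (f x₀) := hf.comp (Continuous.prodMk_right x₀)
  obtain ⟨C, hC⟩ := hK.exists_bound_of_continuousOn h0.continuousOn
  refine ⟨C + 1, hK.eventually_forall_of_forall_eventually fun y hy => ?_⟩
  have h1 : ‖Function.uncurry f (x₀, y)‖ < C + 1 := (hC y hy).trans_lt (lt_add_one C)
  exact (hf.norm.continuousAt.eventually_lt continuousAt_const h1).mono fun _ h => h.le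

variable {d : ℕ}

theorem isInducing_toMatrix : IsInducing fun g : SO d => g.1.1 :=
  (IsInducing.mk rfl : IsInducing fun g : Matrix.SpecialLinearGroup (Idx d) ℝ => g.1).comp
    (IsInducing.mk rfl : IsInducing fun g : SO d => g.1)

/-- Required for dominated convergence with the group element as parameter. -/
instance : FirstCountableTopology (SO d) :=
  have : FirstCountableTopology (Matrix (Idx d) (Idx d) ℝ) :=
    inferInstanceAs (FirstCountableTopology (Idx d → Idx d → ℝ))
  isInducing_toMatrix.firstCountableTopology

theorem continuous_SO_of_entry {X : Type*} [TopologicalSpace X] {g : X → SO d}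
    (h : ∀ i j, Continuous fun x => entry (g x) i j) : Continuous g :=
  isInducing_toMatrix.continuous_iff.2 (continuous_matrix h)

theorem continuous_entry (i j : Idx d) : Continuous fun g : SO d => entry g i j :=
  isInducing_toMatrix.continuous.matrix_elem i j

theorem continuous_unip : Continuous (unip : W d → SO d) := by
  refine continuous_SO_of_entry fun i j => ?_
  change Continuous fun x : W d => unipMat x i j
  rcases i with i | i <;> rcases j with j | j
  · fin_cases i <;> fin_cases j <;> simp [unipMat] <;> fun_prop
  · simp only [unipMat, Matrix.fromBlocks_apply₁₂, Matrix.of_apply]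
    split_ifs <;> fun_prop
  · simp only [unipMat, Matrix.fromBlocks_apply₂₁, Matrix.of_apply]
    split_ifs <;> fun_prop
  · simp only [unipMat, Matrix.fromBlocks_apply₂₂]
    fun_prop

theorem continuous_embed : Continuous (embed : SO d → SO (d + 1)) := by
  refine continuous_SO_of_entry fun i j => ?_
  change Continuous fun g : SO d => embedMat g.1.1 i j
  obtain ⟨i, rfl⟩ := (idxEquiv d).surjective i
  obtain ⟨j, rfl⟩ := (idxEquiv d).surjective j
  rcases i with i | i <;> rcases j with j | j <;> simp only [embedMat, Matrix.reindex_apply,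
    Matrix.submatrix_apply, Equiv.symm_apply_apply, Matrix.fromBlocks_apply₁₁,
    Matrix.fromBlocks_apply₁₂, Matrix.fromBlocks_apply₂₁, Matrix.fromBlocks_apply₂₂]
  · exact continuous_entry i j
  all_goals fun_prop

variable [NeZero d]

/-- The light cone modulo scalars is compact: it is covered by the ball `|x|² ≤ 2` and its image
under `w`, on each of which `f` is bounded locally uniformly in `g`. On the second piece homogeneity
supplies `(2/|x|²)^t`. The factor `3^t` absorbs `1 + |x|² ≤ 3` on the first piece and `2/|x|² ≤
3/(1+|x|²)` on the second. Uniformity near `g₀` is what dominated convergence needs. -/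
theorem exists_eventually_bound {t : ℝ} (ht : 0 ≤ t) {f : SO d → ℂ} (hf : Homog t f)
    (hc : Continuous f) (g₀ : SO d) :
    ∃ C : ℝ, 0 ≤ C ∧
      ∀ᶠ g in 𝓝 g₀, ∀ x : W d, ‖f (g * (unip x * weyl d))‖ ≤ C * (1 + ‖x‖ ^ 2) ^ (-t) := by
  have hK : IsCompact (Metric.closedBall (0 : W d) (√2)) := isCompact_closedBall _ _
  have hbd : ∀ k : SO d, ∃ C : ℝ, ∀ᶠ g in 𝓝 g₀, ∀ x ∈ Metric.closedBall (0 : W d) (√2),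
      ‖f (g * (k * (unip x * weyl d)))‖ ≤ C := fun k =>
    hK.exists_eventually_norm_le (f := fun (g : SO d) (x : W d) =>
      f (g * (k * (unip x * weyl d)))) (hc.comp (continuous_fst.mul (continuous_const.mul
        ((continuous_unip.comp continuous_snd).mul continuous_const)))) g₀
  obtain ⟨C₁, h₁⟩ := hbd 1
  obtain ⟨C₂, h₂⟩ := hbd (weyl d)⁻¹
  have hC : 0 ≤ max (max C₁ C₂) 0 := le_max_right _ _
  refine ⟨max (max C₁ C₂) 0 * 3 ^ t, by positivity, ?_⟩
  filter_upwards [h₁, h₂] with g hg₁ hg₂ x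
  rw [mul_assoc, Real.rpow_neg (by positivity), ← div_eq_mul_inv, ← Real.div_rpow (by positivity)
    (by positivity)]
  rcases le_total (‖x‖ ^ 2) 2 with hx | hx
  · have h3 : 1 ≤ (3 / (1 + ‖x‖ ^ 2)) ^ t := by
      apply Real.one_le_rpow _ ht
      rw [le_div_iff₀ (by positivity)]
      linarith
    have h4 := hg₁ x (by simpa using Real.le_sqrt_of_sq_le hx)
    rw [one_mul] at h4
    calc ‖f (g * (unip x * weyl d))‖ ≤ C₁ := h4
      _ ≤ max (max C₁ C₂) 0 := (le_max_left _ _).trans (le_max_left _ _)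
      _ ≤ _ := le_mul_of_one_le_right hC h3
  · have hx' : 0 < ‖x‖ := by
      rcases (norm_nonneg x).eq_or_lt with h | h
      · rw [← h] at hx; norm_num at hx
      · exact h
    have hx0 : x ≠ 0 := norm_pos_iff.1 hx'
    have h4 := apply_weyl_mul (hf.comp_mul_left (g * (weyl d)⁻¹)) hx0
    have h5 := hg₂ ((2 / ‖x‖ ^ 2) • flip d x) (by
      have h6 : √2 ^ 2 = 2 := Real.sq_sqrt zero_le_two
      rw [mem_closedBall_zero_iff, ← sq_le_sq₀ (norm_nonneg _) (by positivity), h6, norm_smul,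
        LinearIsometryEquiv.norm_map, mul_pow, Real.norm_of_nonneg (by positivity)]
      field_simp
      linarith)
    simp only [mul_assoc, inv_mul_cancel_left] at h4
    simp only [bigCell] at h4 h5
    rw [h4, norm_mul, Complex.norm_real, Real.norm_of_nonneg (by positivity), mul_comm]
    have h7 : (2 / ‖x‖ ^ 2) ^ t ≤ (3 / (1 + ‖x‖ ^ 2)) ^ t := by
      apply Real.rpow_le_rpow (by positivity) _ ht
      rw [div_le_div_iff₀ (by positivity) (by positivity)]
      linarith
    exact mul_le_mul (h5.trans ((le_max_right _ _).trans (le_max_left _ _))) h7 (by positivity) hC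

theorem continuous_bigCell {f : SO d → ℂ} (hf : Continuous f) : Continuous (bigCell f) :=
  hf.comp (continuous_unip.mul continuous_const)

theorem integrable_one_add_norm_sq {u : ℝ} (hu : 0 < u) :
    Integrable fun x : W d => (1 + ‖x‖ ^ 2) ^ (-((d : ℝ) * (1 + u) / 2)) := by
  have hd : (0 : ℝ) < d := Nat.cast_pos.2 (NeZero.pos d)
  have h := integrable_rpow_neg_one_add_norm_sq (E := W d) (μ := volume) (r := (d : ℝ) * (1 + u))
    (by rw [finrank_euclideanSpace, Fintype.card_fin]; nlinarith)
  convert! h using 3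
  ring

variable {u : ℝ}

omit [NeZero d] in
theorem degree_nonneg (hu : -1 ≤ u) : 0 ≤ (d : ℝ) * (1 + u) / 2 := by
  have : 0 ≤ 1 + u := by linarith
  positivity

/-- Used twice: with `k = 1` for the continuity of `I_u f`, and with `k` the conjugate of a function
in `F_{-u}` for the continuity of matrix coefficients. -/
theorem continuous_integral_mul_left (hu : 0 < u) (f : F d u) {k : W d → ℂ}
    (hk : AEStronglyMeasurable k) (hb : ∃ C, ∀ x, ‖k x‖ ≤ C) :
    Continuous fun g : SO d => ∫ x : W d, f.1 (g * (unip x * weyl d)) * k x := by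
  rw [continuous_iff_continuousAt]
  intro g₀
  obtain ⟨C, hC0, hC⟩ := exists_eventually_bound (degree_nonneg (by linarith))
    (homog_of_mem f) f.1.continuous g₀
  obtain ⟨B, hB⟩ := hb
  refine continuousAt_of_dominated (bound := fun x =>
    C * (1 + ‖x‖ ^ 2) ^ (-((d : ℝ) * (1 + u) / 2)) * B) ?_ ?_ ?_ ?_
  · exact Eventually.of_forall fun g => (f.1.continuous.comp (continuous_const.mul
      (continuous_unip.mul continuous_const))).aestronglyMeasurable.mul hk
  · filter_upwards [hC] with g hg
    refine Eventually.of_forall fun x => ?_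
    rw [norm_mul]
    exact mul_le_mul (hg x) (hB x) (norm_nonneg _) (by positivity)
  · exact ((integrable_one_add_norm_sq hu).const_mul C).mul_const B
  · exact Eventually.of_forall fun x => ((f.1.continuous.comp
      (continuous_id.mul continuous_const)).mul continuous_const).continuousAt

theorem integrable_mul_left (hu : 0 < u) (f : F d u) (g : SO d) :
    Integrable fun x : W d => f.1 (g * (unip x * weyl d)) := by
  obtain ⟨C, hC0, hC⟩ := exists_eventually_bound (degree_nonneg (by linarith))
    (homog_of_mem f) f.1.continuous g
  exact ((integrable_one_add_norm_sq hu).const_mul C).mono'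
    (f.1.continuous.comp (continuous_const.mul
      (continuous_unip.mul continuous_const))).aestronglyMeasurable
    (Eventually.of_forall hC.self_of_nhds)

theorem integrable_bigCell (hu : 0 < u) (f : F d u) : Integrable (bigCell f.1) := by
  simpa [bigCell] using! integrable_mul_left hu f 1

theorem exists_bigCell_le (hu : -1 ≤ u) (f : F d u) : ∃ C : ℝ, ∀ x, ‖bigCell f.1 x‖ ≤ C := by
  obtain ⟨C, hC0, hC⟩ := exists_eventually_bound (degree_nonneg hu)
    (homog_of_mem f) f.1.continuous 1
  refine ⟨C, fun x => ?_⟩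
  have h := hC.self_of_nhds x
  rw [one_mul] at h
  refine h.trans (mul_le_of_le_one_right hC0 (Real.rpow_le_one_of_one_le_of_nonpos ?_ ?_))
  · nlinarith [norm_nonneg x]
  · linarith [degree_nonneg (d := d) hu]

/-- By `integral_mul_P` the exponent `d(1+u)/2` becomes `d(1+u)/2 - d = -d(1-u)/2`. -/
theorem intertwine_homog (f : F d u) : Homog ((d : ℝ) * (1 + -u) / 2) (intertwine f.1) := by
  intro g g' c h
  have h1 := integral_mul_P ((homog_of_mem f).comp_mul_left g') (col_inv_mul h)
  simp only [← mul_assoc g'] at h1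
  simp only [mul_inv_cancel, one_mul, bigCell] at h1
  simp only [intertwine, mul_assoc]
  rw [h1]
  congr 4
  ring

theorem exists_intertwine (hu : 0 < u) (f : F d u) :
    ∃ f' : F d (-u), ∀ g : SO d, f'.1 g = intertwine f.1 g := by
  have hc := continuous_integral_mul_left hu f (k := fun _ => 1) aestronglyMeasurable_const
    ⟨1, by simp⟩
  simp only [mul_one, ← mul_assoc] at hc
  exact ⟨⟨⟨_, hc⟩, mem_F_of_homog _ (intertwine_homog f)⟩, fun g => rfl⟩

/-- For `u > 0` the first factor is integrable on the big cell; for `u ≤ 1` the second has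
nonnegative degree, hence is bounded. -/
theorem integrable_pairing (hu : 0 < u) (hu1 : u ≤ 1) (f : F d u) (f' : F d (-u)) :
    Integrable fun x : W d => conj (bigCell f.1 x) * bigCell f'.1 x := by
  obtain ⟨C, hC⟩ := exists_bigCell_le (by linarith) f'
  refine (Integrable.mono' (g := fun x => ‖bigCell f.1 x‖ * C) ?_ ?_ ?_)
  · exact (integrable_bigCell hu f).norm.mul_const C
  · exact ((Complex.continuous_conj.comp (continuous_bigCell f.1.continuous)).mul
      (continuous_bigCell f'.1.continuous)).aestronglyMeasurable
  · refine Eventually.of_forall fun x => ?_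
    rw [norm_mul, RCLike.norm_conj]
    exact mul_le_mul_of_nonneg_left (hC x) (norm_nonneg _)

theorem integralsConverge (hu : 0 < u) (hu1 : u ≤ 1) : IntegralsConverge d u :=
  ⟨fun f g => by simpa only [← mul_assoc] using integrable_mul_left hu f g,
    exists_intertwine hu, integrable_pairing hu hu1⟩

theorem intertwine_leftTranslate (g : SO d) (f : F d u) (x : SO d) :
    intertwine (leftTranslate g f).1 x = intertwine f.1 (g⁻¹ * x) := by
  simp [intertwine, leftTranslate, mul_assoc]

theorem pairing_leftTranslate (g : SO d) (f f' : F d u) (hu : 0 < u) :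
    pairing (leftTranslate g f).1 (intertwine (leftTranslate g f').1) =
      pairing f.1 (intertwine f'.1) := by
  obtain ⟨k, hk⟩ := exists_intertwine hu f'
  have h := pairing_mul_left f k g⁻¹
  have h1 : intertwine f'.1 = k.1 := funext fun x => (hk x).symm
  have h2 : intertwine (leftTranslate g f').1 = fun x => k.1 (g⁻¹ * x) :=
    funext fun x => by rw [intertwine_leftTranslate, hk]
  rw [h1, h2, ← h]
  rfl

end Bounds

/-! ### Powers of the norm as superpositions of Gaussians -/

section Subordination

open Set Real

theorem integral_subordination {a : ℝ} (ha : 0 < a) {r : ℝ} (hr : 0 < r) :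
    ∫ t in Ioi (0 : ℝ), t ^ (a - 1) * rexp (-(π * r ^ 2 * t)) =
      Gamma a * π ^ (-a) * r ^ (-(2 * a)) := by
  rw [integral_rpow_mul_exp_neg_mul_Ioi ha (by positivity), one_div,
    inv_rpow (by positivity), ← rpow_neg (by positivity), mul_rpow (by positivity) (by positivity),
    ← rpow_natCast, ← rpow_mul hr.le]
  push_cast
  ring_nf

theorem integral_subordination_inv {b : ℝ} (hb : 0 < b) {r : ℝ} (hr : 0 < r) :
    ∫ t in Ioi (0 : ℝ), t ^ (-b - 1) * rexp (-(π * r ^ 2 / t)) =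
      Gamma b * π ^ (-b) * r ^ (-(2 * b)) := by
  rw [← integral_subordination hb hr,
    ← integral_comp_rpow_Ioi (fun t => t ^ (b - 1) * rexp (-(π * r ^ 2 * t)))
      (neg_ne_zero.2 one_ne_zero)]
  refine setIntegral_congr_fun measurableSet_Ioi fun t ht => ?_
  have ht' : 0 < t := ht
  simp only [abs_neg, abs_one, one_mul, smul_eq_mul]
  rw [← mul_assoc, ← rpow_mul ht'.le, ← rpow_add ht', rpow_neg_one, div_eq_mul_inv]
  congr 2
  ring

theorem gamma_factor_pos {a : ℝ} (ha : 0 < a) : 0 < Gamma a * π ^ (-a) := by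
  have := Gamma_pos_of_pos ha
  positivity

/-- A non-integrable function has Bochner integral 0, whereas the value computed above is positive.
-/
theorem integrableOn_subordination {a : ℝ} (ha : 0 < a) {r : ℝ} (hr : 0 < r) :
    IntegrableOn (fun t => t ^ (a - 1) * rexp (-(π * r ^ 2 * t))) (Ioi 0) := by
  by_contra h
  have h1 := integral_subordination ha hr
  rw [integral_undef h] at h1
  have := gamma_factor_pos ha
  exact absurd h1 (by positivity)

end Subordination

/-! ### The Parseval identity with a Gaussian kernel -/

section Gaussian

variable {V : Type*} [NormedAddCommGroup V] [InnerProductSpace ℝ V] [MeasurableSpace V]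
  [BorelSpace V] [FiniteDimensional ℝ V]

open Module

theorem norm_fourier_le (f : V → ℂ) (ξ : V) : ‖𝓕 f ξ‖ ≤ ∫ x, ‖f x‖ :=
  VectorFourier.norm_fourierIntegral_le_integral_norm _ _ _ _ _

theorem continuous_fourier {f : V → ℂ} (hf : Integrable f) : Continuous (𝓕 f) :=
  VectorFourier.fourierIntegral_continuous Real.continuous_fourierChar
    (innerSL ℝ).continuous₂ hf

theorem integral_fourier_mul_flip {f g : V → ℂ} (hf : Integrable f) (hg : Integrable g) :
    ∫ ξ, 𝓕 f ξ * g ξ = ∫ x, f x * 𝓕 g x := by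
  have h := VectorFourier.integral_fourierIntegral_smul_eq_flip (L := innerₗ V)
    Real.continuous_fourierChar continuous_inner hf hg
  have h1 : (innerₗ V).flip = innerₗ V := by
    ext x y
    simp
  rw [h1] at h
  exact h

theorem conj_fourier (f : V → ℂ) (ξ : V) : conj (𝓕 f ξ) = 𝓕 (fun x => conj (f (-x))) ξ := by
  rw [Real.fourier_eq', Real.fourier_eq', ← integral_conj,
    ← integral_neg_eq_self]
  congr 1
  ext x
  simp [← Complex.exp_conj, Complex.conj_ofNat]

/-- The Gaussian whose Fourier transform is `exp (-π t ‖x‖ ^ 2)`. -/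
noncomputable def dualGaussian (t : ℝ) (ξ : V) : ℝ :=
  t ^ (-((finrank ℝ V : ℝ) / 2)) * Real.exp (-(Real.pi * ‖ξ‖ ^ 2 / t))

omit [MeasurableSpace V] [BorelSpace V] [FiniteDimensional ℝ V] in
theorem dualGaussian_nonneg {t : ℝ} (ht : 0 < t) (ξ : V) : 0 ≤ dualGaussian t ξ := by
  unfold dualGaussian
  positivity

theorem integrable_dualGaussian {t : ℝ} (ht : 0 < t) : Integrable (dualGaussian t : V → ℝ) := by
  have hb : 0 < ((Real.pi / t : ℝ) : ℂ).re := by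
    rw [Complex.ofReal_re]; positivity
  have h := (GaussianFourier.integrable_cexp_neg_mul_sq_norm_add (V := V) hb 0 0).norm.const_mul
    (t ^ (-((finrank ℝ V : ℝ) / 2)))
  refine h.congr (Filter.Eventually.of_forall fun ξ => ?_)
  simp only [dualGaussian, Complex.norm_exp]
  congr 2
  simp [← Complex.ofReal_pow]
  ring

theorem fourier_dualGaussian_mul {t : ℝ} (ht : 0 < t) (y w : V) :
    𝓕 (fun ξ : V => Complex.exp ((↑(-2 * Real.pi * ⟪ξ, y⟫_ℝ) * Complex.I)) *
      (dualGaussian t ξ : ℂ)) w = (Real.exp (-(Real.pi * ‖w + y‖ ^ 2 * t)) : ℂ) := by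
  have hb : 0 < ((Real.pi / t : ℝ) : ℂ).re := by
    rw [Complex.ofReal_re]; positivity
  have h := fourier_gaussian_innerProductSpace' hb (-y) w
  have hfun : (fun ξ : V => Complex.exp ((↑(-2 * Real.pi * ⟪ξ, y⟫_ℝ) * Complex.I)) *
      (dualGaussian t ξ : ℂ)) = ((t ^ (-((finrank ℝ V : ℝ) / 2)) : ℝ) : ℂ) •
        fun ξ : V => Complex.exp (-((Real.pi / t : ℝ) : ℂ) * ‖ξ‖ ^ 2 +
          2 * Real.pi * Complex.I * ⟪-y, ξ⟫_ℝ) := by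
    ext ξ
    simp only [dualGaussian, Complex.ofReal_mul, Complex.ofReal_exp, Pi.smul_apply, smul_eq_mul]
    rw [mul_left_comm, ← Complex.exp_add]
    congr 2
    rw [inner_neg_left, real_inner_comm]
    push_cast
    ring
  rw [hfun]
  have h2 : 𝓕 (((t ^ (-((finrank ℝ V : ℝ) / 2)) : ℝ) : ℂ) •
        fun ξ : V => Complex.exp (-((Real.pi / t : ℝ) : ℂ) * ‖ξ‖ ^ 2 +
          2 * Real.pi * Complex.I * ⟪-y, ξ⟫_ℝ)) w = ((t ^ (-((finrank ℝ V : ℝ) / 2)) : ℝ) : ℂ) *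
      𝓕 (fun ξ : V => Complex.exp (-((Real.pi / t : ℝ) : ℂ) * ‖ξ‖ ^ 2 +
          2 * Real.pi * Complex.I * ⟪-y, ξ⟫_ℝ)) w := by
    rw [Real.fourier_eq', Real.fourier_eq', ← integral_const_mul]
    congr 1
    ext ξ
    simp only [Pi.smul_apply, smul_eq_mul]
    ring
  have h3 : (Real.pi : ℂ) / ((Real.pi / t : ℝ) : ℂ) = (t : ℂ) := by
    have : (Real.pi : ℂ) ≠ 0 := by exact_mod_cast Real.pi_ne_zero
    have : (t : ℂ) ≠ 0 := by exact_mod_cast ht.ne'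
    push_cast
    field_simp
  have h4 : (t : ℂ) ^ ((finrank ℝ V : ℂ) / 2) = ((t ^ ((finrank ℝ V : ℝ) / 2) : ℝ) : ℂ) := by
    rw [Complex.ofReal_cpow ht.le]
    push_cast
    rfl
  have h5 : ‖-y - w‖ = ‖w + y‖ := by rw [← norm_neg]; congr 1; abel
  rw [h2, h, h3, h4, ← mul_assoc, ← Complex.ofReal_mul, ← Real.rpow_add ht, neg_add_cancel,
    Real.rpow_zero, Complex.ofReal_one, one_mul, h5, Complex.ofReal_exp]
  congr 1
  have : (Real.pi : ℂ) ≠ 0 := by exact_mod_cast Real.pi_ne_zero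
  have : (t : ℂ) ≠ 0 := by exact_mod_cast ht.ne'
  push_cast
  field_simp

theorem integrable_mul_dualGaussian {t : ℝ} (ht : 0 < t) {k : V → ℂ} (hk : Continuous k)
    (hb : ∃ C, ∀ x, ‖k x‖ ≤ C) : Integrable fun ξ => k ξ * (dualGaussian t ξ : ℂ) := by
  obtain ⟨C, hC⟩ := hb
  exact (integrable_dualGaussian ht).ofReal.bdd_mul (c := C) hk.aestronglyMeasurable
    (Filter.Eventually.of_forall hC)

theorem bounded_fourier (f : V → ℂ) : ∃ C, ∀ ξ, ‖𝓕 f ξ‖ ≤ C :=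
  ⟨_, norm_fourier_le f⟩

/-- The Gaussian makes everything converge for merely integrable `f` and `g`. Both Fourier
transforms are moved onto it by self-adjointness: first that of `g`, then that of `f`, using that
`conj (𝓕 f)` is the transform of `x ↦ conj (f (-x))`. -/
theorem integral_gaussian_kernel {t : ℝ} (ht : 0 < t) {f g : V → ℂ} (hf : Integrable f)
    (hg : Integrable g) :
    ∫ ξ, conj (𝓕 f ξ) * 𝓕 g ξ * (dualGaussian t ξ : ℂ) =
      ∫ y, ∫ x, conj (f x) * g y * (Real.exp (-(Real.pi * ‖x - y‖ ^ 2 * t)) : ℂ) := by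
  obtain ⟨C, hC⟩ := bounded_fourier f
  have hcf : Continuous fun ξ => conj (𝓕 f ξ) :=
    Complex.continuous_conj.comp (continuous_fourier hf)
  have h1 : Integrable fun ξ => conj (𝓕 f ξ) * (dualGaussian t ξ : ℂ) :=
    integrable_mul_dualGaussian ht hcf ⟨C, fun ξ => by rw [RCLike.norm_conj]; exact hC ξ⟩
  have h2 := integral_fourier_mul_flip hg h1
  have hf' : Integrable fun x => conj (f (-x)) := by
    have := hf.comp_neg
    exact (Complex.conjLIE.integrable_comp_iff).2 this
  have h3 : ∀ y, 𝓕 (fun ξ => conj (𝓕 f ξ) * (dualGaussian t ξ : ℂ)) y =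
      ∫ x, conj (f x) * (Real.exp (-(Real.pi * ‖x - y‖ ^ 2 * t)) : ℂ) := by
    intro y
    have h4 : Integrable fun ξ : V => Complex.exp ((↑(-2 * Real.pi * ⟪ξ, y⟫_ℝ) * Complex.I)) *
        (dualGaussian t ξ : ℂ) := by
      refine integrable_mul_dualGaussian ht (by fun_prop) ⟨1, fun ξ => ?_⟩
      rw [Complex.norm_exp_ofReal_mul_I]
    have h5 := integral_fourier_mul_flip hf' h4
    simp only [← conj_fourier, fourier_dualGaussian_mul ht] at h5
    rw [Real.fourier_eq']
    simp only [smul_eq_mul]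
    rw [← integral_neg_eq_self (fun x => conj (f x) *
      (Real.exp (-(Real.pi * ‖x - y‖ ^ 2 * t)) : ℂ))]
    have h6 : ∀ x : V, ‖-x - y‖ = ‖x + y‖ := fun x => by rw [← norm_neg]; congr 1; abel
    simp only [h6]
    rw [← h5]
    congr 1
    ext ξ
    ring
  simp only [h3] at h2
  calc _ = ∫ ξ, 𝓕 g ξ * (conj (𝓕 f ξ) * (dualGaussian t ξ : ℂ)) := by
        congr 1; ext ξ; ring
    _ = _ := h2
    _ = _ := by
      congr 1
      ext y
      rw [← integral_const_mul]
      congr 1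
      ext x
      ring

end Gaussian

/-! ### The Fourier transform of the Riesz kernel -/

section RieszKernel

variable {V : Type*} [NormedAddCommGroup V] [InnerProductSpace ℝ V] [MeasurableSpace V]
  [BorelSpace V] [FiniteDimensional ℝ V]

open Module Set Filter

/-- The kernel is split at `|x - y| = 1`. The near part is integrable because `l < dim V`, and is
convolved with the integrable `f` against the bounded `g`; the far part is at most 1, and `f ⊗ g` is
integrable. -/
theorem integrable_riesz_double [Nontrivial V] {f g : V → ℂ} (hf : Integrable f)
    (hg : Integrable g) (hb : ∃ C, ∀ x, ‖g x‖ ≤ C) {l : ℝ} (hl0 : 0 ≤ l)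
    (hl : l < finrank ℝ V) :
    Integrable (fun p : V × V => ‖p.1 - p.2‖ ^ (-l) * (‖f p.1‖ * ‖g p.2‖))
      (volume.prod volume) := by
  obtain ⟨C, hC⟩ := hb
  have hC0 : 0 ≤ C := (norm_nonneg _).trans (hC 0)
  let k : V → ℝ := (Metric.ball 0 1).indicator fun z => ‖z‖ ^ (-l)
  have hm : Measurable fun z : V => ‖z‖ ^ (-l) := by fun_prop
  have hk : Integrable k := by
    refine IntegrableOn.integrable_indicator ?_ measurableSet_ball
    refine integrableOn_ball_of_norm_le_rpow (C := 1) (α := l) finrank_pos hl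
      (Eventually.of_forall fun x => ?_) hm.aestronglyMeasurable
    rw [one_mul, Real.norm_of_nonneg (by positivity)]
  have h1 := (Integrable.convolution_integrand (ContinuousLinearMap.mul ℝ ℝ) hf.norm hk).const_mul C
  have h1' := h1.swap
  have h2 := hf.norm.mul_prod hg.norm
  refine (h1'.add h2).mono' ?_ (Eventually.of_forall fun p => ?_)
  · exact (hm.comp (measurable_fst.sub measurable_snd)).aestronglyMeasurable.mul
      (hf.norm.aestronglyMeasurable.comp_fst.mul hg.norm.aestronglyMeasurable.comp_snd)
  · rw [Real.norm_of_nonneg (by positivity)]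
    simp only [Pi.add_apply, Function.comp_apply, Prod.swap, ContinuousLinearMap.mul_apply']
    by_cases hp : p.1 - p.2 ∈ Metric.ball (0 : V) 1
    · have hp' : p.2 - p.1 ∈ Metric.ball (0 : V) 1 := by
        rw [mem_ball_zero_iff] at hp ⊢
        rwa [norm_sub_rev]
      have h3 : k (p.2 - p.1) = ‖p.1 - p.2‖ ^ (-l) := by
        simp only [k]
        rw [Set.indicator_of_mem hp', norm_sub_rev]
      rw [h3]
      have h4 : ‖p.1 - p.2‖ ^ (-l) * (‖f p.1‖ * ‖g p.2‖) ≤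
          ‖p.1 - p.2‖ ^ (-l) * (‖f p.1‖ * C) := by
        gcongr
        exact hC _
      have h5 : 0 ≤ ‖f p.1‖ * ‖g p.2‖ := by positivity
      linarith
    · have h3 : ‖p.1 - p.2‖ ^ (-l) ≤ 1 := by
        rw [mem_ball_zero_iff, not_lt] at hp
        exact Real.rpow_le_one_of_one_le_of_nonpos hp (by linarith)
      have hk0 : 0 ≤ k (p.2 - p.1) := Set.indicator_nonneg (fun _ _ => by positivity) _
      have h4 : ‖p.1 - p.2‖ ^ (-l) * (‖f p.1‖ * ‖g p.2‖) ≤ 1 * (‖f p.1‖ * ‖g p.2‖) := by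
        gcongr
      have h5 : 0 ≤ C * (‖f p.1‖ * k (p.2 - p.1)) := by positivity
      linarith

theorem ae_prod_ne [Nontrivial V] : ∀ᵐ p : V × V ∂(volume.prod volume), p.1 - p.2 ≠ 0 := by
  have hms : MeasurableSet {p : V × V | ¬ (p.1 - p.2 ≠ 0)} := by
    simp only [not_not]
    exact measurableSet_eq_fun (by fun_prop) measurable_const
  rw [ae_iff, Measure.measure_prod_null hms]
  refine Eventually.of_forall fun x => ?_
  have : Prod.mk x ⁻¹' {p : V × V | ¬ (p.1 - p.2 ≠ 0)} = {x} := by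
    ext y
    simp [sub_eq_zero, eq_comm]
  change volume (Prod.mk x ⁻¹' {p : V × V | ¬ (p.1 - p.2 ≠ 0)}) = 0
  rw [this, measure_singleton]

theorem integrable_subordinated [Nontrivial V] {f g : V → ℂ} (hf : Integrable f)
    (hg : Integrable g) (hb : ∃ C, ∀ x, ‖g x‖ ≤ C) {a : ℝ} (ha : 0 < a)
    (hl : 2 * a < finrank ℝ V) :
    Integrable (fun q : (V × V) × ℝ => conj (f q.1.1) * g q.1.2 *
        ((q.2 ^ (a - 1) * Real.exp (-(Real.pi * ‖q.1.1 - q.1.2‖ ^ 2 * q.2)) : ℝ) : ℂ))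
      ((volume.prod volume).prod (volume.restrict (Ioi 0))) := by
  have hfg : AEStronglyMeasurable (fun p : V × V => conj (f p.1) * g p.2)
      (volume.prod volume) :=
    (Complex.continuous_conj.comp_aestronglyMeasurable hf.aestronglyMeasurable.comp_fst).mul
      hg.aestronglyMeasurable.comp_snd
  have hm : Measurable fun q : (V × V) × ℝ =>
      ((q.2 ^ (a - 1) * Real.exp (-(Real.pi * ‖q.1.1 - q.1.2‖ ^ 2 * q.2)) : ℝ) : ℂ) := by
    fun_prop
  have hmeas : AEStronglyMeasurable (fun q : (V × V) × ℝ => conj (f q.1.1) * g q.1.2 *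
        ((q.2 ^ (a - 1) * Real.exp (-(Real.pi * ‖q.1.1 - q.1.2‖ ^ 2 * q.2)) : ℝ) : ℂ))
      ((volume.prod volume).prod (volume.restrict (Ioi 0))) :=
    hfg.comp_fst.mul hm.aestronglyMeasurable
  refine (integrable_prod_iff hmeas).2 ⟨?_, ?_⟩
  · filter_upwards [ae_prod_ne] with p hp
    exact ((integrableOn_subordination ha (norm_pos_iff.2 hp)).ofReal (𝕜 := ℂ)).const_mul _
  · refine ((integrable_riesz_double hf hg hb (l := 2 * a) (by positivity) hl).const_mul
      (Real.Gamma a * Real.pi ^ (-a))).congr ?_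
    filter_upwards [ae_prod_ne] with p hp
    rw [← mul_assoc, ← integral_subordination ha (norm_pos_iff.2 hp), ← integral_mul_const]
    refine setIntegral_congr_fun measurableSet_Ioi fun t ht => ?_
    have ht' : (0 : ℝ) < t := ht
    simp only [norm_mul, RCLike.norm_conj, Complex.norm_real]
    rw [Real.norm_of_nonneg (by positivity), Real.norm_of_nonneg (by positivity)]
    ring

-- Because `a - dim V / 2 = -b`, transforming the Gaussians in the subordination formula for
-- exponent `2a` yields the inverted formula for the dual exponent `2b`.
omit [MeasurableSpace V] [BorelSpace V] [FiniteDimensional ℝ V] in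
theorem subordinated_kernel_eq {a t : ℝ} (ht : 0 < t) {b : ℝ}
    (hab : 2 * a + 2 * b = finrank ℝ V) (ξ : V) :
    t ^ (a - 1) * dualGaussian t ξ =
      t ^ (-b - 1) * Real.exp (-(Real.pi * ‖ξ‖ ^ 2 / t)) := by
  rw [dualGaussian, ← mul_assoc, ← Real.rpow_add ht]
  congr 2
  linarith

theorem integral_subordinated {f g : V → ℂ} (hf : Integrable f)
    (hg : Integrable g) {a t : ℝ} (ht : 0 < t)
    (hint : Integrable (fun p : V × V => conj (f p.1) * g p.2 *
        ((t ^ (a - 1) * Real.exp (-(Real.pi * ‖p.1 - p.2‖ ^ 2 * t)) : ℝ) : ℂ))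
      (volume.prod volume)) :
    ∫ p : V × V, conj (f p.1) * g p.2 *
        ((t ^ (a - 1) * Real.exp (-(Real.pi * ‖p.1 - p.2‖ ^ 2 * t)) : ℝ) : ℂ)
        ∂(volume.prod volume) =
      ∫ ξ, conj (𝓕 f ξ) * 𝓕 g ξ * ((t ^ (a - 1) * dualGaussian t ξ : ℝ) : ℂ) := by
  rw [integral_prod_symm _ hint]
  have h := integral_gaussian_kernel ht hf hg
  calc _ = ((t ^ (a - 1) : ℝ) : ℂ) * ∫ y, ∫ x, conj (f x) * g y *
        (Real.exp (-(Real.pi * ‖x - y‖ ^ 2 * t)) : ℂ) := by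
        rw [← integral_const_mul]
        congr 1
        ext y
        rw [← integral_const_mul]
        congr 1
        ext x
        push_cast
        ring
    _ = _ := by
        rw [← h, ← integral_const_mul]
        congr 1
        ext ξ
        push_cast
        ring

theorem ae_ne_zero' [Nontrivial V] : ∀ᵐ x : V, x ≠ 0 := by
  simp [ae_iff]

omit [FiniteDimensional ℝ V] in
theorem measurable_subordinated_dual (a : ℝ) : Measurable fun q : V × ℝ =>
    ((q.2 ^ (a - 1) * dualGaussian q.2 q.1 : ℝ) : ℂ) := by
  unfold dualGaussian
  fun_prop

/-- For `g = f` the integrand on the Fourier side is nonnegative, so for each `t` its norm integral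
over `ξ` equals its integral, which the Gaussian identity evaluates on the other side, where
integrability in `t` is known. Thus no prior decay of `𝓕 f` is needed, and integrating out `t` shows
that `𝓕 f` lies in the weighted `L²` space. -/
theorem integrable_subordinated_dual_self [Nontrivial V] {f : V → ℂ} (hf : Integrable f)
    (hb : ∃ C, ∀ x, ‖f x‖ ≤ C) {a : ℝ} (ha : 0 < a) (hl : 2 * a < finrank ℝ V) :
    Integrable (fun q : V × ℝ => conj (𝓕 f q.1) * 𝓕 f q.1 *
        ((q.2 ^ (a - 1) * dualGaussian q.2 q.1 : ℝ) : ℂ))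
      (volume.prod (volume.restrict (Ioi 0))) := by
  have hcont := continuous_fourier hf
  have hcc : Continuous fun ξ => conj (𝓕 f ξ) * 𝓕 f ξ :=
    (Complex.continuous_conj.comp hcont).mul hcont
  have hQ := integrable_subordinated hf hf hb ha hl
  have hslice := hQ.swap.prod_right_ae
  have hmeas : AEStronglyMeasurable (fun q : V × ℝ => conj (𝓕 f q.1) * 𝓕 f q.1 *
        ((q.2 ^ (a - 1) * dualGaussian q.2 q.1 : ℝ) : ℂ))
      (volume.prod (volume.restrict (Ioi 0))) :=
    ((hcc.measurable.comp measurable_fst).mul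
      (measurable_subordinated_dual a)).aestronglyMeasurable
  refine (integrable_prod_iff' hmeas).2 ⟨?_, ?_⟩
  · filter_upwards [ae_restrict_mem measurableSet_Ioi] with t ht
    obtain ⟨C, hC⟩ := bounded_fourier f
    have h := (integrable_mul_dualGaussian ht hcc ⟨C * C, fun ξ => by
      rw [norm_mul, RCLike.norm_conj]
      exact mul_le_mul (hC ξ) (hC ξ) (norm_nonneg _) ((norm_nonneg _).trans (hC ξ))⟩).const_mul
        ((t ^ (a - 1) : ℝ) : ℂ)
    refine h.congr (Eventually.of_forall fun ξ => ?_)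
    simp only
    push_cast
    ring
  · refine hQ.integral_prod_right.re.congr ?_
    filter_upwards [ae_restrict_mem measurableSet_Ioi, hslice] with t ht hint
    have ht' : (0 : ℝ) < t := ht
    have h1 := integral_subordinated hf hf ht' hint
    have h2 : ∀ ξ, conj (𝓕 f ξ) * 𝓕 f ξ * ((t ^ (a - 1) * dualGaussian t ξ : ℝ) : ℂ) =
        ((‖conj (𝓕 f ξ) * 𝓕 f ξ * ((t ^ (a - 1) * dualGaussian t ξ : ℝ) : ℂ)‖ : ℝ) : ℂ) := by
      intro ξ
      have h3 := dualGaussian_nonneg ht' ξ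
      rw [Complex.conj_mul', norm_mul, Complex.norm_real, Real.norm_of_nonneg (by positivity)]
      simp
    rw [integral_congr_ae (Eventually.of_forall h2), integral_complex_ofReal] at h1
    exact (congrArg Complex.re h1).trans (Complex.ofReal_re _)

omit [MeasurableSpace V] [BorelSpace V] [FiniteDimensional ℝ V] in
theorem integral_subordinated_dual {a b : ℝ} (hb : 0 < b) (hab : 2 * a + 2 * b = finrank ℝ V)
    (z : ℂ) {ξ : V} (hξ : ξ ≠ 0) :
    ∫ t in Ioi (0 : ℝ), z * ((t ^ (a - 1) * dualGaussian t ξ : ℝ) : ℂ) =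
      z * ((Real.Gamma b * Real.pi ^ (-b) * ‖ξ‖ ^ (-(2 * b)) : ℝ) : ℂ) := by
  rw [← integral_subordination_inv hb (norm_pos_iff.2 hξ), ← integral_complex_ofReal,
    ← integral_const_mul]
  refine setIntegral_congr_fun measurableSet_Ioi fun t ht => ?_
  rw [subordinated_kernel_eq ht hab]

theorem integrable_fourier_sq [Nontrivial V] {f : V → ℂ} (hf : Integrable f)
    (hbd : ∃ C, ∀ x, ‖f x‖ ≤ C) {b : ℝ} (hb : 0 < b) (hl : 2 * b < finrank ℝ V) :
    Integrable fun ξ => ‖𝓕 f ξ‖ ^ 2 * ‖ξ‖ ^ (-(2 * b)) := by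
  have h := integrable_subordinated_dual_self hf hbd (a := (finrank ℝ V : ℝ) / 2 - b)
    (by linarith) (by linarith)
  have hc := gamma_factor_pos hb
  refine (h.integral_prod_left.norm.const_mul (Real.Gamma b * Real.pi ^ (-b))⁻¹).congr ?_
  filter_upwards [ae_ne_zero'] with ξ hξ
  rw [integral_subordinated_dual hb (by ring) _ hξ, Complex.conj_mul', norm_mul,
    Complex.norm_real, Real.norm_of_nonneg (by positivity), norm_pow, Complex.norm_real,
    norm_norm]
  field_simp

/-- The mixed case is dominated by the two diagonal ones, as `|zw| ≤ |z|² + |w|²`. -/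
theorem integrable_subordinated_dual [Nontrivial V] {f g : V → ℂ} (hf : Integrable f)
    (hbf : ∃ C, ∀ x, ‖f x‖ ≤ C) (hg : Integrable g)
    (hbg : ∃ C, ∀ x, ‖g x‖ ≤ C) {a : ℝ} (ha : 0 < a) (hl : 2 * a < finrank ℝ V) :
    Integrable (fun q : V × ℝ => conj (𝓕 f q.1) * 𝓕 g q.1 *
        ((q.2 ^ (a - 1) * dualGaussian q.2 q.1 : ℝ) : ℂ))
      (volume.prod (volume.restrict (Ioi 0))) := by
  refine ((integrable_subordinated_dual_self hf hbf ha hl).norm.add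
    (integrable_subordinated_dual_self hg hbg ha hl).norm).mono' ?_
    (Eventually.of_forall fun q => ?_)
  · exact ((((Complex.continuous_conj.comp (continuous_fourier hf)).mul
      (continuous_fourier hg)).measurable.comp measurable_fst).mul
      (measurable_subordinated_dual a)).aestronglyMeasurable
  · simp only [Pi.add_apply, norm_mul, RCLike.norm_conj, ← add_mul]
    refine mul_le_mul_of_nonneg_right ?_ (norm_nonneg _)
    nlinarith [sq_nonneg (‖𝓕 f q.1‖ - ‖𝓕 g q.1‖), sq_nonneg (‖𝓕 f q.1‖),
      sq_nonneg (‖𝓕 g q.1‖)]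

/-- The Fourier transform diagonalizes the Riesz potentials. -/
theorem riesz_eq_fourier [Nontrivial V] {f g : V → ℂ} (hf : Integrable f)
    (hbf : ∃ C, ∀ x, ‖f x‖ ≤ C) (hg : Integrable g) (hbg : ∃ C, ∀ x, ‖g x‖ ≤ C)
    {a b : ℝ} (ha : 0 < a) (hb : 0 < b) (hab : 2 * a + 2 * b = finrank ℝ V) :
    ((Real.Gamma a * Real.pi ^ (-a) : ℝ) : ℂ) *
      ∫ p : V × V, ((‖p.1 - p.2‖ ^ (-(2 * a)) : ℝ) : ℂ) * (conj (f p.1) * g p.2)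
        ∂(volume.prod volume) =
      ((Real.Gamma b * Real.pi ^ (-b) : ℝ) : ℂ) *
        ∫ ξ, ((‖ξ‖ ^ (-(2 * b)) : ℝ) : ℂ) * (conj (𝓕 f ξ) * 𝓕 g ξ) := by
  have hQ := integrable_subordinated hf hg hbg ha (by linarith)
  have hR := integrable_subordinated_dual hf hbf hg hbg ha (by linarith)
  -- Both sides are integrals over `t` of the two sides of the Gaussian identity, with the order of
  -- integration exchanged.
  have h1 := integral_integral_swap (f := fun (p : V × V) (t : ℝ) => conj (f p.1) * g p.2 *
    ((t ^ (a - 1) * Real.exp (-(Real.pi * ‖p.1 - p.2‖ ^ 2 * t)) : ℝ) : ℂ)) hQ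
  have h2 := integral_integral_swap (f := fun (ξ : V) (t : ℝ) => conj (𝓕 f ξ) * 𝓕 g ξ *
    ((t ^ (a - 1) * dualGaussian t ξ : ℝ) : ℂ)) hR
  have h3 : ∫ t in Ioi (0 : ℝ), ∫ p : V × V, conj (f p.1) * g p.2 *
        ((t ^ (a - 1) * Real.exp (-(Real.pi * ‖p.1 - p.2‖ ^ 2 * t)) : ℝ) : ℂ)
        ∂(volume.prod volume) = ∫ t in Ioi (0 : ℝ), ∫ ξ, conj (𝓕 f ξ) * 𝓕 g ξ *
          ((t ^ (a - 1) * dualGaussian t ξ : ℝ) : ℂ) := by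
    apply integral_congr_ae
    filter_upwards [ae_restrict_mem measurableSet_Ioi, hQ.swap.prod_right_ae] with t ht hint
    exact integral_subordinated hf hg ht hint
  rw [h3, ← h2] at h1
  rw [← integral_const_mul, ← integral_const_mul]
  refine Eq.trans (integral_congr_ae ?_) (h1.trans (integral_congr_ae ?_))
  · filter_upwards [ae_prod_ne] with p hp
    rw [integral_const_mul, integral_complex_ofReal,
      integral_subordination ha (norm_pos_iff.2 hp)]
    push_cast
    ring
  · filter_upwards [ae_ne_zero'] with ξ hξ
    rw [integral_subordinated_dual hb hab _ hξ]
    push_cast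
    ring

end RieszKernel

/-! ### The weighted `L²` space and the isometry of the normalized Fourier transform -/

section Weight

open Set Filter

variable {d : ℕ} {u : ℝ}

theorem measurable_density : Measurable fun x : W d =>
    ENNReal.ofReal (‖x‖ ^ (-((d : ℝ) * u))) := by
  fun_prop

theorem integrable_weight_iff {E : Type*} [NormedAddCommGroup E] [NormedSpace ℝ E] {f : W d → E} :
    Integrable f (weight d u) ↔ Integrable fun x => ‖x‖ ^ (-((d : ℝ) * u)) • f x := by
  rw [weight, integrable_withDensity_iff_integrable_smul' measurable_density
    (Eventually.of_forall fun _ => ENNReal.ofReal_lt_top)]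
  congr! 3 with x
  rw [ENNReal.toReal_ofReal (by positivity)]

theorem integral_weight {E : Type*} [NormedAddCommGroup E] [NormedSpace ℝ E] (f : W d → E) :
    ∫ x, f x ∂(weight d u) = ∫ x, ‖x‖ ^ (-((d : ℝ) * u)) • f x := by
  rw [weight, integral_withDensity_eq_integral_toReal_smul measurable_density
    (Eventually.of_forall fun _ => ENNReal.ofReal_lt_top)]
  congr! 2 with x
  rw [ENNReal.toReal_ofReal (by positivity)]

variable [NeZero d]

/-- The singularity at 0 is integrable because `du < d`; outside the unit ball the weight is at most
1. This gives the temperate growth and local finiteness on which the density of Schwartz functions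
rests. -/
theorem integrable_weight_one_add (hu0 : 0 ≤ u) (hu1 : u < 1) :
    Integrable (fun x : W d => (1 + ‖x‖) ^ (-((d + 1 : ℕ) : ℝ))) (weight d u) := by
  have hd : (0 : ℝ) < d := Nat.cast_pos.2 (NeZero.pos d)
  have hfin : Module.finrank ℝ (W d) = d := by simp
  rw [integrable_weight_iff]
  have h1 : Integrable ((Metric.ball (0 : W d) 1).indicator
      fun x : W d => ‖x‖ ^ (-((d : ℝ) * u))) := by
    refine IntegrableOn.integrable_indicator ?_ measurableSet_ball
    refine integrableOn_ball_of_norm_le_rpow (C := 1) (α := d * u)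
      (by rw [hfin]; exact NeZero.one_le) (by rw [hfin]; nlinarith)
      (Eventually.of_forall fun x => ?_) (Measurable.aestronglyMeasurable (by fun_prop))
    rw [one_mul, Real.norm_of_nonneg (by positivity)]
  have h2 : Integrable fun x : W d => (1 + ‖x‖) ^ (-((d + 1 : ℕ) : ℝ)) :=
    integrable_one_add_norm (by rw [hfin]; push_cast; linarith)
  refine (h1.add h2).mono' (Measurable.aestronglyMeasurable (by fun_prop))
    (Eventually.of_forall fun x => ?_)
  rw [Real.norm_of_nonneg (by positivity), Pi.add_apply, smul_eq_mul]
  have h3 : (0 : ℝ) ≤ (1 + ‖x‖) ^ (-((d + 1 : ℕ) : ℝ)) := by positivity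
  by_cases hx : x ∈ Metric.ball (0 : W d) 1
  · rw [Set.indicator_of_mem hx]
    have h4 : (1 + ‖x‖) ^ (-((d + 1 : ℕ) : ℝ)) ≤ 1 :=
      Real.rpow_le_one_of_one_le_of_nonpos (by linarith [norm_nonneg x])
        (neg_nonpos.2 (Nat.cast_nonneg _))
    have h5 : (0 : ℝ) ≤ ‖x‖ ^ (-((d : ℝ) * u)) := by positivity
    nlinarith
  · rw [Set.indicator_of_notMem hx]
    rw [mem_ball_zero_iff, not_lt] at hx
    have h4 : ‖x‖ ^ (-((d : ℝ) * u)) ≤ 1 :=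
      Real.rpow_le_one_of_one_le_of_nonpos hx (by nlinarith)
    nlinarith

theorem hasTemperateGrowth_weight (hu0 : 0 ≤ u) (hu1 : u < 1) :
    (weight d u).HasTemperateGrowth :=
  ⟨d + 1, integrable_weight_one_add hu0 hu1⟩

theorem isFiniteMeasureOnCompacts_weight (hu0 : 0 ≤ u) (hu1 : u < 1) :
    IsFiniteMeasureOnCompacts (weight d u) := by
  refine ⟨fun K hK => ?_⟩
  obtain ⟨R, hR0, hR⟩ := hK.isBounded.exists_pos_norm_le
  refine (measure_mono fun x hx => ?_).trans_lt
    ((integrable_weight_one_add (d := d) hu0 hu1).measure_ge_lt_top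
      (ε := (1 + R) ^ (-((d + 1 : ℕ) : ℝ))) (by positivity))
  exact Real.rpow_le_rpow_of_nonpos (by positivity) (by linarith [hR x hx])
    (neg_nonpos.2 (Nat.cast_nonneg _))

theorem memLp_fourier (hu : 0 < u) (hu1 : u < 1) {f : W d → ℂ} (hf : Integrable f)
    (hb : ∃ C, ∀ x, ‖f x‖ ≤ C) : MemLp (𝓕 f) 2 (weight d u) := by
  have hd : (0 : ℝ) < d := Nat.cast_pos.2 (NeZero.pos d)
  have hfin : (Module.finrank ℝ (W d) : ℝ) = d := by simp
  rw [memLp_two_iff_integrable_sq_norm (continuous_fourier hf).aestronglyMeasurable,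
    integrable_weight_iff]
  have h := integrable_fourier_sq hf hb (b := d * u / 2) (by positivity) (by rw [hfin]; nlinarith)
  convert! h using 2 with ξ
  rw [smul_eq_mul, mul_comm]
  congr 2
  ring

/-- The factor by which the Fourier transform has to be multiplied to become isometric. -/
noncomputable def fourierConst (d : ℕ) (u : ℝ) : ℝ :=
  √(2 ^ ((d : ℝ) * (1 - u) / 2) *
    ((Real.Gamma (d * u / 2) * Real.pi ^ (-(d * u / 2) : ℝ)) /
      (Real.Gamma (d * (1 - u) / 2) * Real.pi ^ (-(d * (1 - u) / 2) : ℝ))))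

theorem fourierConst_arg_pos (hu : 0 < u) (hu1 : u < 1) :
    0 < (2 : ℝ) ^ ((d : ℝ) * (1 - u) / 2) *
    ((Real.Gamma (d * u / 2) * Real.pi ^ (-(d * u / 2) : ℝ)) /
      (Real.Gamma (d * (1 - u) / 2) * Real.pi ^ (-(d * (1 - u) / 2) : ℝ))) := by
  have hd : (0 : ℝ) < d := Nat.cast_pos.2 (NeZero.pos d)
  have h1 := gamma_factor_pos (a := d * u / 2) (by positivity)
  have h1u : 0 < 1 - u := by linarith
  have h2 := gamma_factor_pos (a := d * (1 - u) / 2) (by positivity)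
  positivity

theorem fourierConst_pos (hu : 0 < u) (hu1 : u < 1) : 0 < fourierConst d u :=
  Real.sqrt_pos.2 (fourierConst_arg_pos hu hu1)

theorem pairing_intertwine_eq_riesz (hu : 0 < u) (hu1 : u < 1) (f f' : F d u) :
    pairing f.1 (intertwine f'.1) = ((2 ^ ((d : ℝ) * (1 - u) / 2) : ℝ) : ℂ) *
      ∫ p : W d × W d, ((‖p.1 - p.2‖ ^ (-((d : ℝ) * (1 - u))) : ℝ) : ℂ) *
        (conj (bigCell f.1 p.1) * bigCell f'.1 p.2) ∂(volume.prod volume) := by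
  have hd : (0 : ℝ) < d := Nat.cast_pos.2 (NeZero.pos d)
  have hfin : (Module.finrank ℝ (W d) : ℝ) = d := by simp
  have h1u : 0 < 1 - u := by linarith
  have hi := integrable_bigCell hu f
  have hi' := integrable_bigCell hu f'
  have hint : Integrable (fun p : W d × W d =>
      ((‖p.1 - p.2‖ ^ (-((d : ℝ) * (1 - u))) : ℝ) : ℂ) *
        (conj (bigCell f.1 p.1) * bigCell f'.1 p.2)) (volume.prod volume) := by
    have h := integrable_riesz_double hi hi' (exists_bigCell_le (by linarith) f')
      (l := d * (1 - u)) (by positivity) (by rw [hfin]; nlinarith)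
    refine h.mono' ?_ (Eventually.of_forall fun p => ?_)
    · refine AEStronglyMeasurable.mul (Measurable.aestronglyMeasurable (by fun_prop)) ?_
      exact (Complex.continuous_conj.comp_aestronglyMeasurable
        hi.aestronglyMeasurable.comp_fst).mul hi'.aestronglyMeasurable.comp_snd
    · rw [norm_mul, norm_mul, RCLike.norm_conj, Complex.norm_real,
        Real.norm_of_nonneg (by positivity)]
  rw [integral_prod _ hint, ← integral_const_mul, pairing]
  congr 1
  ext y
  rw [show bigCell (intertwine f'.1) y = intertwine f'.1 (unip y * weyl d) from rfl,
    intertwine_unip_weyl, mul_left_comm, ← integral_const_mul]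
  congr 1
  -- Translating by `y` turns the convolution form `bigCell f' (y + x)` into a kernel in the
  -- difference of the two variables.
  rw [← integral_add_left_eq_self (fun w => ((‖y - w‖ ^ (-((d : ℝ) * (1 - u))) : ℝ) : ℂ) *
    (conj (bigCell f.1 y) * bigCell f'.1 w)) y]
  congr 1
  ext x
  rw [sub_add_cancel_left, norm_neg]
  ring

theorem pairing_intertwine_eq_fourier (hu : 0 < u) (hu1 : u < 1) (f f' : F d u) :
    pairing f.1 (intertwine f'.1) = ((fourierConst d u ^ 2 : ℝ) : ℂ) *
      ∫ ξ, ((‖ξ‖ ^ (-((d : ℝ) * u)) : ℝ) : ℂ) *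
        (conj (𝓕 (bigCell f.1) ξ) * 𝓕 (bigCell f'.1) ξ) := by
  have hd : (0 : ℝ) < d := Nat.cast_pos.2 (NeZero.pos d)
  have hfin : (Module.finrank ℝ (W d) : ℝ) = d := by simp
  have h1u : 0 < 1 - u := by linarith
  have ha2 : 2 * (d * (1 - u) / 2) = d * (1 - u) := by ring
  have hb2 : 2 * (d * u / 2) = d * u := by ring
  have key := riesz_eq_fourier (integrable_bigCell hu f) (exists_bigCell_le (by linarith) f)
    (integrable_bigCell hu f') (exists_bigCell_le (by linarith) f')
    (a := d * (1 - u) / 2) (b := d * u / 2)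
    (by positivity) (by positivity) (by rw [hfin]; ring)
  rw [ha2, hb2] at key
  have hg := gamma_factor_pos (a := d * (1 - u) / 2) (by positivity)
  rw [pairing_intertwine_eq_riesz hu hu1, fourierConst,
    Real.sq_sqrt (fourierConst_arg_pos hu hu1).le]
  have hg' : ((Real.Gamma (d * (1 - u) / 2) * Real.pi ^ (-(d * (1 - u) / 2) : ℝ) : ℝ) : ℂ) ≠ 0 :=
    Complex.ofReal_ne_zero.2 hg.ne'
  rw [Complex.ofReal_mul, mul_assoc, Complex.ofReal_div, div_mul_eq_mul_div, ← key,
    mul_div_cancel_left₀ _ hg']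

omit [NeZero d] in
theorem fourier_add_apply {f g : W d → ℂ} (hf : Integrable f) (hg : Integrable g) (ξ : W d) :
    𝓕 (f + g) ξ = 𝓕 f ξ + 𝓕 g ξ := by
  rw [show 𝓕 (f + g) = 𝓕 f + 𝓕 g from
    (VectorFourier.fourierIntegral_add Real.continuous_fourierChar continuous_inner hf hg)]
  rfl

omit [NeZero d] in
theorem fourier_smul_apply (c : ℂ) (f : W d → ℂ) (ξ : W d) : 𝓕 (c • f) ξ = c * 𝓕 f ξ := by
  rw [Real.fourier_eq', Real.fourier_eq', ← integral_const_mul]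
  congr 1
  ext ξ
  simp only [Pi.smul_apply, smul_eq_mul]
  ring

/-- The normalized Fourier transform on the big cell, as a map to the weighted `L ^ 2` space. -/
noncomputable def fourierLp (d : ℕ) [NeZero d] {u : ℝ} (hu : 0 < u) (hu1 : u < 1) :
    F d u →ₗ[ℂ] WHat d u where
  toFun f := ((memLp_fourier hu hu1 (integrable_bigCell hu f)
    (exists_bigCell_le (by linarith) f)).const_mul (fourierConst d u : ℂ)).toLp _
  map_add' f g := by
    rw [← MemLp.toLp_add]
    congr 1
    ext ξ
    rw [Pi.add_apply, ← mul_add,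
      ← fourier_add_apply (integrable_bigCell hu f) (integrable_bigCell hu g)]
    rfl
  map_smul' c f := by
    rw [RingHom.id_apply, ← MemLp.toLp_const_smul]
    congr 1
    ext ξ
    rw [Pi.smul_apply, smul_eq_mul, mul_left_comm, ← fourier_smul_apply c]
    rfl

theorem coeFn_fourierLp (hu : 0 < u) (hu1 : u < 1) (f : F d u) :
    (fourierLp d hu hu1 f : W d → ℂ) =ᵐ[weight d u]
      fun ξ => (fourierConst d u : ℂ) * 𝓕 (bigCell f.1) ξ :=
  MemLp.coeFn_toLp ((memLp_fourier hu hu1 (integrable_bigCell hu f)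
    (exists_bigCell_le (by linarith) f)).const_mul (fourierConst d u : ℂ))

theorem inner_fourierLp (hu : 0 < u) (hu1 : u < 1) (f f' : F d u) :
    ⟪fourierLp d hu hu1 f, fourierLp d hu hu1 f'⟫_ℂ = pairing f.1 (intertwine f'.1) := by
  rw [pairing_intertwine_eq_fourier hu hu1, L2.inner_def, ← integral_const_mul]
  rw [← integral_congr_ae (f := fun ξ => ⟪(fourierConst d u : ℂ) * 𝓕 (bigCell f.1) ξ,
    (fourierConst d u : ℂ) * 𝓕 (bigCell f'.1) ξ⟫_ℂ), integral_weight]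
  · congr 1
    ext ξ
    rw [RCLike.inner_apply, map_mul, Complex.conj_ofReal, Complex.real_smul]
    push_cast
    ring
  · filter_upwards [coeFn_fourierLp hu hu1 f, coeFn_fourierLp hu hu1 f'] with ξ h h'
    rw [h, h']

end Weight

/-! ### Extending functions from the big cell to the group -/

section Extension

open Filter Topology

variable {d : ℕ}

/-- The middle coordinates of `g e_0`. -/
def colMid (g : SO d) : W d := WithLp.toLp 2 fun i => col g (Sum.inr i)

theorem norm_colMid_sq (g : SO d) :
    ‖colMid g‖ ^ 2 = 2 * col g (Sum.inl 0) * col g (Sum.inl 1) := by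
  rw [col_isotropic, ← sum_sq_eq_norm]
  rfl

theorem continuous_col (i : Idx d) : Continuous fun g : SO d => col g i :=
  continuous_entry i _

theorem continuous_colMid : Continuous (colMid : SO d → W d) :=
  (PiLp.continuous_toLp 2 _).comp (continuous_pi fun i => continuous_col (Sum.inr i))

theorem col_zero_ne_zero {g : SO d} (h : col g (Sum.inl 1) = 0) : col g (Sum.inl 0) ≠ 0 := by
  intro h0
  have h1 : colMid g = 0 := by
    have := norm_colMid_sq g
    rw [h, mul_zero] at this
    simpa using this
  apply col_ne_zero g
  ext i
  rcases i with i | i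
  · fin_cases i
    · exact h0
    · exact h
  · exact congrArg (fun v : W d => v i) h1

/-- The homogeneous function on the group with restriction `s` to the big cell, which vanishes
outside of the big cell. -/
noncomputable def cellExtend (t : ℝ) (s : W d → ℂ) (g : SO d) : ℂ :=
  ((|col g (Sum.inl 1)| ^ (-t) : ℝ) : ℂ) * s ((col g (Sum.inl 1))⁻¹ • colMid g)

theorem homog_cellExtend (t : ℝ) (s : W d → ℂ) : Homog t (cellExtend t s) := by
  intro g g' c h
  have hc := smul_ne_zero_of_col h
  have h1 : col g (Sum.inl 1) = c * col g' (Sum.inl 1) := congrFun h _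
  have h2 : colMid g = c • colMid g' := by
    ext i
    exact congrFun h (Sum.inr i)
  rw [cellExtend, cellExtend, h1, h2, abs_mul, Real.mul_rpow (abs_nonneg _) (abs_nonneg _),
    Complex.ofReal_mul, mul_assoc, smul_smul, _root_.mul_inv_rev, mul_assoc, inv_mul_cancel₀ hc, mul_one]

theorem bigCell_cellExtend [NeZero d] (t : ℝ) (s : W d → ℂ) : bigCell (cellExtend t s) = s := by
  ext x
  have h : colMid (unip x * weyl d) = x := by
    ext i
    rw [colMid, col_unip_weyl]
    rfl
  rw [bigCell, cellExtend, h, col_unip_weyl]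
  simp

/-- Write `a`, `b` for the first and last coordinates of `g e_0`. By isotropy the point of the big
cell has squared norm `2|a|/|b|`. One more power of decay than the degree requires leaves the factor
`|b|`, which tends to 0 at the complement of the cell, so that the extension by zero is continuous.
-/
theorem norm_cellExtend_le {t : ℝ} (ht : 0 < t) {s : W d → ℂ} {C : ℝ}
    (hs : ∀ x, ‖s x‖ ≤ C * (1 + ‖x‖ ^ 2) ^ (-(t + 1))) {g : SO d}
    (h0 : col g (Sum.inl 0) ≠ 0) :
    ‖cellExtend t s g‖ ≤
      C * ((2 * |col g (Sum.inl 0)|) ^ (-(t + 1)) * |col g (Sum.inl 1)|) := by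
  have hC : 0 ≤ C := by
    have := (norm_nonneg _).trans (hs 0)
    simpa using this
  set a := col g (Sum.inl 0)
  set b := col g (Sum.inl 1)
  have ha : 0 < |a| := abs_pos.2 h0
  rw [cellExtend, norm_mul, Complex.norm_real, Real.norm_of_nonneg (by positivity)]
  by_cases hb : b = 0
  · change |b| ^ (-t) * _ ≤ _
    rw [hb, abs_zero, Real.zero_rpow (by linarith), zero_mul]
    positivity
  · have hb' : 0 < |b| := abs_pos.2 hb
    have h1 : ‖b⁻¹ • colMid g‖ ^ 2 = 2 * |a| / |b| := by
      have h2 : 2 * a * b = |2 * a * b| := by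
        rw [abs_of_nonneg]
        rw [← norm_colMid_sq]
        positivity
      rw [norm_smul, mul_pow, norm_colMid_sq, norm_inv, Real.norm_eq_abs]
      change |b|⁻¹ ^ 2 * (2 * a * b) = _
      rw [h2, abs_mul, abs_mul, abs_two]
      field_simp
    have h3 : (1 + ‖b⁻¹ • colMid g‖ ^ 2) ^ (-(t + 1)) ≤ (2 * |a| / |b|) ^ (-(t + 1)) := by
      rw [h1]
      exact Real.rpow_le_rpow_of_nonpos (by positivity) (by linarith) (by linarith)
    calc |b| ^ (-t) * ‖s (b⁻¹ • colMid g)‖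
        ≤ |b| ^ (-t) * (C * (2 * |a| / |b|) ^ (-(t + 1))) := by
          gcongr
          exact (hs _).trans (by gcongr)
      _ = C * ((2 * |a|) ^ (-(t + 1)) * |b|) := by
          rw [Real.div_rpow (by positivity) (by positivity), Real.rpow_neg hb'.le (t + 1),
            Real.rpow_add_one hb'.ne', Real.rpow_neg hb'.le]
          field_simp

theorem continuous_cellExtend {t : ℝ} (ht : 0 < t) {s : W d → ℂ} (hc : Continuous s)
    (hs : ∃ C, ∀ x, ‖s x‖ ≤ C * (1 + ‖x‖ ^ 2) ^ (-(t + 1))) :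
    Continuous (cellExtend t s) := by
  obtain ⟨C, hC⟩ := hs
  rw [continuous_iff_continuousAt]
  intro g₀
  have hl := (continuous_col (d := d) (Sum.inl 1)).continuousAt (x := g₀)
  by_cases h : col g₀ (Sum.inl 1) = 0
  · have h0 := col_zero_ne_zero h
    have hz := (continuous_col (d := d) (Sum.inl 0)).continuousAt (x := g₀)
    have hval : cellExtend t s g₀ = 0 := by
      rw [cellExtend, h, abs_zero, Real.zero_rpow (by linarith)]
      simp
    rw [ContinuousAt, hval]
    have hlim : ContinuousAt (fun g : SO d =>
        C * ((2 * |col g (Sum.inl 0)|) ^ (-(t + 1)) * |col g (Sum.inl 1)|)) g₀ :=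
      continuousAt_const.mul (((continuousAt_const.mul hz.abs).rpow_const
        (Or.inl (mul_pos two_pos (abs_pos.2 h0)).ne')).mul hl.abs)
    rw [ContinuousAt, h, abs_zero, mul_zero, mul_zero] at hlim
    refine squeeze_zero_norm' ?_ hlim
    filter_upwards [hz.eventually_ne h0] with g hg
    exact norm_cellExtend_le ht hC hg
  · refine ContinuousAt.mul ?_ ?_
    · exact Complex.continuous_ofReal.continuousAt.comp
        (hl.abs.rpow_const (Or.inl (abs_ne_zero.2 h)))
    · exact hc.continuousAt.comp ((hl.inv₀ h).smul continuous_colMid.continuousAt)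

theorem exists_bigCell_eq [NeZero d] {u : ℝ} (hu : -1 < u) {s : W d → ℂ} (hc : Continuous s)
    (hs : ∃ C, ∀ x, ‖s x‖ ≤ C * (1 + ‖x‖ ^ 2) ^ (-((d : ℝ) * (1 + u) / 2 + 1))) :
    ∃ f : F d u, bigCell f.1 = s := by
  have hd : (0 : ℝ) < d := Nat.cast_pos.2 (NeZero.pos d)
  have h1 : 0 < 1 + u := by linarith
  exact ⟨⟨⟨_, continuous_cellExtend (by positivity) hc hs⟩, mem_F_of_homog _ (homog_cellExtend _ _)⟩,
    bigCell_cellExtend _ _⟩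

theorem exists_bigCell_eq_of_hasCompactSupport [NeZero d] {u : ℝ} (hu : -1 < u) {s : W d → ℂ}
    (hc : Continuous s) (hs : HasCompactSupport s) : ∃ f : F d u, bigCell f.1 = s := by
  refine exists_bigCell_eq hu hc ?_
  have hc' : Continuous fun x : W d =>
      (((1 + ‖x‖ ^ 2) ^ ((d : ℝ) * (1 + u) / 2 + 1) : ℝ) : ℂ) * s x := by
    refine (Complex.continuous_ofReal.comp (Continuous.rpow_const (by fun_prop) fun x => ?_)).mul hc
    exact Or.inl (by positivity)
  obtain ⟨C, hC⟩ := hc'.bounded_above_of_compact_support (hs.mul_left)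
  refine ⟨C, fun x => ?_⟩
  have h := hC x
  rw [norm_mul, Complex.norm_real, Real.norm_of_nonneg (by positivity)] at h
  rw [Real.rpow_neg (by positivity), ← div_eq_mul_inv, le_div_iff₀ (by positivity)]
  linarith

theorem exists_bigCell_eq_schwartz [NeZero d] {u : ℝ} (hu : -1 < u) (s : SchwartzMap (W d) ℂ) :
    ∃ f : F d u, bigCell f.1 = s := by
  refine exists_bigCell_eq hu s.continuous ?_
  obtain ⟨k, hk⟩ := exists_nat_ge (2 * ((d : ℝ) * (1 + u) / 2 + 1))
  obtain ⟨C, hC⟩ : ∃ C : ℝ, ∀ x, (1 + ‖x‖) ^ k * ‖s x‖ ≤ C := ⟨_, fun x => by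
    simpa only [norm_iteratedFDeriv_zero] using
      SchwartzMap.one_add_le_sup_seminorm_apply (𝕜 := ℝ) (m := (k, 0)) le_rfl le_rfl s x⟩
  refine ⟨C, fun x => ?_⟩
  have h := hC x
  rw [Real.rpow_neg (by positivity), ← div_eq_mul_inv, le_div_iff₀ (by positivity), mul_comm]
  refine le_trans ?_ h
  gcongr
  have h1 : (1 : ℝ) ≤ 1 + ‖x‖ := by linarith [norm_nonneg x]
  have h0 := degree_nonneg (d := d) hu.le
  calc (1 + ‖x‖ ^ 2) ^ ((d : ℝ) * (1 + u) / 2 + 1)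
      ≤ ((1 + ‖x‖) ^ (2 : ℝ)) ^ ((d : ℝ) * (1 + u) / 2 + 1) := by
        refine Real.rpow_le_rpow (by positivity) ?_ (by linarith)
        rw [Real.rpow_two]
        nlinarith [norm_nonneg x]
    _ = (1 + ‖x‖) ^ (2 * ((d : ℝ) * (1 + u) / 2 + 1)) := by
        rw [← Real.rpow_mul (by positivity)]
    _ ≤ (1 + ‖x‖) ^ (k : ℝ) := Real.rpow_le_rpow_of_exponent_le h1 hk
    _ = _ := Real.rpow_natCast _ _

end Extension

/-! ### Existence of the complementary series and its Fourier model -/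

section Existence

open Filter Topology

variable {d : ℕ} [NeZero d] {u : ℝ}

/-- Schwartz functions are dense in the weighted space, and each is the image of a function in
`F_u`: its inverse Fourier transform is again Schwartz, hence decays fast enough to extend from the
big cell. -/
theorem dense_fourierLp_schwartz (hu : 0 < u) (hu1 : u < 1) :
    Dense (fourierLp d hu hu1 '' {f | ∃ s : SchwartzMap (W d) ℂ, ∀ x, bigCell f.1 x = s x}) := by
  have := hasTemperateGrowth_weight (d := d) hu.le hu1
  have := isFiniteMeasureOnCompacts_weight (d := d) hu.le hu1
  have hdense := SchwartzMap.denseRange_toLpCLM (E := W d) (F := ℂ) (p := 2)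
    (μ := weight d u) ENNReal.ofNat_ne_top
  refine hdense.mono ?_
  rintro _ ⟨φ, rfl⟩
  have hc : (fourierConst d u : ℂ) ≠ 0 := Complex.ofReal_ne_zero.2 (fourierConst_pos hu hu1).ne'
  obtain ⟨f, hf⟩ := exists_bigCell_eq_schwartz (u := u) (by linarith)
    ((fourierConst d u : ℂ)⁻¹ • (𝓕⁻ φ : SchwartzMap (W d) ℂ))
  refine ⟨f, ⟨_, fun x => congrFun hf x⟩, ?_⟩
  apply Lp.ext
  filter_upwards [coeFn_fourierLp hu hu1 f, SchwartzMap.coeFn_toLp φ 2 (weight d u)] with ξ h1 h2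
  rw [h1, SchwartzMap.toLpCLM_apply, h2, hf]
  have h3 : 𝓕 (⇑((fourierConst d u : ℂ)⁻¹ • (𝓕⁻ φ : SchwartzMap (W d) ℂ))) ξ =
      (fourierConst d u : ℂ)⁻¹ * φ ξ := by
    have h4 : ⇑((fourierConst d u : ℂ)⁻¹ • (𝓕⁻ φ : SchwartzMap (W d) ℂ)) =
      (fourierConst d u : ℂ)⁻¹ • ⇑(𝓕⁻ φ : SchwartzMap (W d) ℂ) := rfl
    rw [h4, fourier_smul_apply, ← SchwartzMap.fourier_coe, FourierTransform.fourier_fourierInv_eq]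
  rw [h3, mul_inv_cancel_left₀ hc]

/-- Left translation as an equivalence. -/
noncomputable def leftTranslateEquiv (g : SO d) : F d u ≃ₗ[ℂ] F d u :=
  LinearEquiv.ofLinearMap (leftTranslate g) (leftTranslate g⁻¹)
    (by ext f x; simp [leftTranslate]) (by ext f x; simp [leftTranslate])

omit [NeZero d] in
theorem leftTranslate_mul (g h : SO d) (f : F d u) :
    leftTranslate (g * h) f = leftTranslate g (leftTranslate h f) := by
  ext x
  simp [leftTranslate, mul_assoc]

omit [NeZero d] in
theorem leftTranslate_one (f : F d u) : leftTranslate 1 f = f := by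
  ext x
  simp [leftTranslate]

variable {E : Type*} [NormedAddCommGroup E] [InnerProductSpace ℂ E]

theorem continuous_pairing_leftTranslate (hu : 0 < u) (hu1 : u ≤ 1) (f : F d u)
    (k : F d (-u)) : Continuous fun g : SO d => pairing (leftTranslate g f).1 k.1 := by
  obtain ⟨C, hC⟩ := exists_bigCell_le (by linarith) k
  have h := continuous_integral_mul_left hu f (k := fun x => conj (bigCell k.1 x))
    (Complex.continuous_conj.comp (continuous_bigCell k.1.continuous)).aestronglyMeasurable
    ⟨C, fun x => by rw [RCLike.norm_conj]; exact hC x⟩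
  refine (Complex.continuous_conj.comp (h.comp continuous_inv)).congr fun g => ?_
  simp only [Function.comp_apply, ← integral_conj, pairing, map_mul, Complex.conj_conj]
  rfl

/-- For norm-preserving translations weak continuity implies strong continuity: `‖gf - g₀f‖² = 2‖f‖²
- 2 Re ⟨gf, I_u(g₀f)⟩`, and the last term is continuous in `g`. -/
theorem continuous_leftTranslate (hu : 0 < u) (hu1 : u ≤ 1) (ι : F d u →ₗ[ℂ] E)
    (hι : ∀ f f' : F d u, ⟪ι f, ι f'⟫_ℂ = pairing f.1 (intertwine f'.1)) (f : F d u) :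
    Continuous fun g : SO d => ι (leftTranslate g f) := by
  rw [continuous_iff_continuousAt]
  intro g₀
  obtain ⟨k, hk⟩ := exists_intertwine hu (leftTranslate g₀ f)
  have hk' : intertwine (leftTranslate g₀ f).1 = k.1 := funext fun x => (hk x).symm
  have hnorm : ∀ g : SO d, ‖ι (leftTranslate g f)‖ ^ 2 = ‖ι f‖ ^ 2 := by
    intro g
    have h : ⟪ι (leftTranslate g f), ι (leftTranslate g f)⟫_ℂ = ⟪ι f, ι f⟫_ℂ := by
      rw [hι, hι, pairing_leftTranslate g f f hu]
    rw [inner_self_eq_norm_sq_to_K, inner_self_eq_norm_sq_to_K] at h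
    exact_mod_cast h
  have hsq : ∀ g : SO d, ‖ι (leftTranslate g f) - ι (leftTranslate g₀ f)‖ ^ 2 =
      2 * ‖ι f‖ ^ 2 - 2 * RCLike.re (pairing (leftTranslate g f).1 k.1) := by
    intro g
    rw [@norm_sub_sq ℂ, hnorm, hnorm, hι, hk']
    ring
  have hcont : Continuous fun g : SO d =>
      ‖ι (leftTranslate g f) - ι (leftTranslate g₀ f)‖ ^ 2 := by
    simp_rw [hsq]
    exact continuous_const.sub (continuous_const.mul
      (RCLike.continuous_re.comp (continuous_pairing_leftTranslate hu hu1 f k)))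
  have h0 := (Real.continuous_sqrt.comp hcont).continuousAt (x := g₀)
  simp only [ContinuousAt, Function.comp_def, Real.sqrt_sq (norm_nonneg _), sub_self,
    norm_zero, ne_eq, OfNat.ofNat_ne_zero, not_false_eq_true, zero_pow, Real.sqrt_zero] at h0
  exact tendsto_iff_norm_sub_tendsto_zero.2 h0

theorem exists_isometry_extending {V E E' : Type*} [AddCommMonoid V] [Module ℂ V]
    [NormedAddCommGroup E] [InnerProductSpace ℂ E] [CompleteSpace E] [NormedAddCommGroup E']
    [InnerProductSpace ℂ E'] [CompleteSpace E'] (e : V ≃ₗ[ℂ] V) (ι : V →ₗ[ℂ] E) (κ : V →ₗ[ℂ] E')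
    (hι : DenseRange ι) (hκ : DenseRange κ) (h : ∀ f, ‖κ (e f)‖ = ‖ι f‖) :
    ∃ U : E ≃ₗᵢ[ℂ] E', ∀ f, U (ι f) = κ (e f) :=
  letI : AddCommGroup V := Module.addCommMonoidToAddCommGroup ℂ
  ⟨e.extendOfIsometry ι κ hι hκ h, fun f => LinearEquiv.extendOfIsometry_eq e ι κ hι hκ h f⟩

theorem exists_representation [CompleteSpace E] (hu : 0 < u) (hu1 : u < 1) (ι : F d u →ₗ[ℂ] E)
    (hinner : ∀ f f' : F d u, ⟪ι f, ι f'⟫_ℂ = pairing f.1 (intertwine f'.1))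
    (hd : Dense (ι '' {f | ∃ s : SchwartzMap (W d) ℂ, ∀ x, bigCell f.1 x = s x})) :
    ∃ π : SO d →* (E ≃ₗᵢ[ℂ] E), IsComplementarySeries π ι := by
  have hι : DenseRange ι := hd.mono (Set.image_subset_range _ _)
  have hnorm : ∀ (g : SO d) (f : F d u), ‖ι (leftTranslateEquiv g f)‖ = ‖ι f‖ := by
    intro g f
    have h : ⟪ι (leftTranslate g f), ι (leftTranslate g f)⟫_ℂ = ⟪ι f, ι f⟫_ℂ := by
      rw [hinner, hinner, pairing_leftTranslate g f f hu]
    rw [inner_self_eq_norm_sq_to_K, inner_self_eq_norm_sq_to_K] at h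
    rw [← sq_eq_sq₀ (norm_nonneg _) (norm_nonneg _)]
    exact_mod_cast h
  choose U hU' using fun g : SO d =>
    exists_isometry_extending (leftTranslateEquiv g) ι ι hι hι (hnorm g)
  have hU : ∀ (g : SO d) (f : F d u), U g (ι f) = ι (leftTranslate g f) := hU'
  have hext : ∀ A B : E ≃ₗᵢ[ℂ] E, (∀ f, A (ι f) = B (ι f)) → A = B := by
    intro A B h
    ext1 v
    exact congrFun (hι.equalizer A.continuous B.continuous (funext h)) v
  let π : SO d →* (E ≃ₗᵢ[ℂ] E) :=
    { toFun := U
      map_one' := hext _ _ fun f => by rw [hU, leftTranslate_one]; rfl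
      map_mul' := fun g h => hext _ _ fun f => by
        change U (g * h) (ι f) = U g (U h (ι f))
        rw [hU, hU, hU, leftTranslate_mul] }
  refine ⟨π, hinner, hd, hU, fun v => ?_⟩
  -- Replacing `v` by a nearby `ι f` costs the same error for all `g`, since each `U g` is an
  -- isometry; orbit maps are thus uniform limits of continuous ones.
  refine continuous_of_uniform_approx_of_continuous fun s hs => ?_
  obtain ⟨ε, hε, hεs⟩ := Metric.mem_uniformity_dist.1 hs
  obtain ⟨f, hf⟩ := hι.exists_dist_lt v hε
  refine ⟨fun g => ι (leftTranslate g f), continuous_leftTranslate hu hu1.le ι hinner f,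
    fun g => hεs ?_⟩
  change dist (U g v) (ι (leftTranslate g f)) < ε
  rw [← hU]
  exact ((U g).isometry.dist_eq v (ι f)).trans_lt hf

/-- The complementary series, realized in the weighted `L ^ 2` space. -/
theorem exists_complementarySeries (hu : 0 < u) (hu1 : u < 1) :
    ∃ (π : SO d →* (WHat d u ≃ₗᵢ[ℂ] WHat d u)) (ι : F d u →ₗ[ℂ] WHat d u),
      IsComplementarySeries π ι := by
  obtain ⟨π, hπ⟩ := exists_representation hu hu1 (fourierLp d hu hu1) (inner_fourierLp hu hu1)
    (dense_fourierLp_schwartz hu hu1)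
  exact ⟨π, _, hπ⟩

/-- The normalized Fourier transform identifies every realization of the complementary series
with the weighted `L ^ 2` space. -/
theorem exists_fourier_equiv [CompleteSpace E] (hu : 0 < u) (hu1 : u < 1)
    {π : SO d →* (E ≃ₗᵢ[ℂ] E)} {ι : F d u →ₗ[ℂ] E} (h : IsComplementarySeries π ι) :
    ∃ A : E ≃ₗᵢ[ℂ] WHat d u, ∀ f, A (ι f) = fourierLp d hu hu1 f := by
  have hι : DenseRange ι := h.dense.mono (Set.image_subset_range _ _)
  have hκ : DenseRange (fourierLp d hu hu1) :=
    (dense_fourierLp_schwartz hu hu1).mono (Set.image_subset_range _ _)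
  have hnorm : ∀ f : F d u, ‖fourierLp d hu hu1 (LinearEquiv.refl ℂ _ f)‖ = ‖ι f‖ := by
    intro f
    have h1 : ⟪fourierLp d hu hu1 f, fourierLp d hu hu1 f⟫_ℂ = ⟪ι f, ι f⟫_ℂ := by
      rw [inner_fourierLp, h.inner_eq]
    rw [inner_self_eq_norm_sq_to_K, inner_self_eq_norm_sq_to_K] at h1
    rw [← sq_eq_sq₀ (norm_nonneg _) (norm_nonneg _)]
    exact_mod_cast h1
  exact exists_isometry_extending (LinearEquiv.refl ℂ (F d u)) ι _ hι hκ hnorm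

end Existence

/-! ### Constant extension along the last coordinate -/

section ExtendConst

open Set Filter

variable {d : ℕ}

theorem forgetLast_snocPt (y : W d) (t : ℝ) : forgetLast (snocPt y t) = y := by
  ext i
  simp [forgetLast, snocPt]

theorem continuous_forgetLast : Continuous (forgetLast : W (d + 1) → W d) := by
  unfold forgetLast
  fun_prop

/-- The volume preserving splitting `ℝ × ℝ ^ d = ℝ ^ (d + 1)`. -/
def snocEquiv (d : ℕ) : ℝ × W d ≃ᵐ W (d + 1) :=
  ((MeasurableEquiv.prodCongr (MeasurableEquiv.refl ℝ)
    (MeasurableEquiv.toLp 2 (Fin d → ℝ)).symm).trans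
    (MeasurableEquiv.piFinSuccAbove (fun _ => ℝ) (Fin.last d)).symm).trans
    (MeasurableEquiv.toLp 2 (Fin (d + 1) → ℝ))

theorem snocEquiv_apply (p : ℝ × W d) : snocEquiv d p = snocPt p.2 p.1 := by
  ext i
  change (Fin.last d).insertNth (α := fun _ => ℝ) p.1 p.2.ofLp i = _
  rw [Fin.insertNth_last']
  rfl

theorem measurePreserving_snocEquiv : MeasurePreserving (snocEquiv d) := by
  refine (PiLp.volume_preserving_toLp (Fin (d + 1))).comp
    ((volume_preserving_piFinSuccAbove (fun _ => ℝ) (Fin.last d)).symm.comp ?_)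
  exact (MeasurePreserving.id volume).prod (PiLp.volume_preserving_ofLp (Fin d))

theorem lintegral_snoc {f : W (d + 1) → ENNReal} (hf : Measurable f) :
    ∫⁻ x, f x = ∫⁻ y : W d, ∫⁻ t : ℝ, f (snocPt y t) := by
  rw [← measurePreserving_snocEquiv.lintegral_comp hf, Measure.volume_eq_prod,
    lintegral_prod_symm' (fun p => f (snocEquiv d p)) (hf.comp (snocEquiv d).measurable)]
  simp_rw [snocEquiv_apply]

/-- The normalizing constant `C` of the extension of functions. -/
theorem integrable_extension_weight {s : ℝ} (hs : 1 < s) :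
    Integrable fun t : ℝ => (1 + t ^ 2) ^ (-(s / 2)) := by
  have h := integrable_rpow_neg_one_add_norm_sq (E := ℝ) (μ := volume) (r := s)
    (by simpa using hs)
  convert! h using 3 with t
  · simp
  · ring

theorem integral_extension_weight_pos {s : ℝ} (hs : 1 < s) :
    0 < ∫ t : ℝ, (1 + t ^ 2) ^ (-(s / 2)) := by
  rw [integral_pos_iff_support_of_nonneg (fun t => by positivity)
    (integrable_extension_weight hs)]
  have : Function.support (fun t : ℝ => (1 + t ^ 2) ^ (-(s / 2))) = univ := by
    ext t
    simp only [Function.mem_support, mem_univ, iff_true]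
    positivity
  rw [this]
  simp

theorem lintegral_extension_weight {s : ℝ} (hs : 1 < s) {r : ℝ} (hr : 0 < r) :
    ∫⁻ t : ℝ, ENNReal.ofReal ((r ^ 2 + t ^ 2) ^ (-(s / 2))) =
      ENNReal.ofReal (r ^ (1 - s) * ∫ t : ℝ, (1 + t ^ 2) ^ (-(s / 2))) := by
  have h1 : ∀ t : ℝ, (r ^ 2 + t ^ 2) ^ (-(s / 2)) =
      r ^ (-s) * (1 + (r⁻¹ * t) ^ 2) ^ (-(s / 2)) := by
    intro t
    have h2 : r ^ 2 + t ^ 2 = r ^ 2 * (1 + (r⁻¹ * t) ^ 2) := by field_simp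
    rw [h2, Real.mul_rpow (by positivity) (by positivity), ← Real.rpow_natCast, ← Real.rpow_mul
      hr.le]
    congr 2
    push_cast
    ring
  simp_rw [h1]
  rw [← ofReal_integral_eq_lintegral_ofReal]
  · rw [integral_const_mul, Measure.integral_comp_mul_left
      (fun t : ℝ => (1 + t ^ 2) ^ (-(s / 2))), inv_inv, abs_of_pos hr, smul_eq_mul, ← mul_assoc,
      ← Real.rpow_add_one hr.ne', neg_add_eq_sub]
  · exact ((integrable_extension_weight hs).comp_mul_left' (inv_ne_zero hr.ne')).const_mul _
  · exact Eventually.of_forall fun t => by positivity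

variable [NeZero d] {u u' : ℝ}

/-- The source of the relation between `u` and `u'`: by scaling, the weight integrated over the
fibre above `y` is `C |y|^(1-(d+1)u) = C |y|^(-du')`. Up to `C`, the weighted measure downstairs is
therefore the image of the one upstairs. -/
theorem lintegral_comp_forgetLast (hu : 1 < ((d : ℝ) + 1) * u)
    (hu' : (d : ℝ) * u' = ((d : ℝ) + 1) * u - 1) {g : W d → ENNReal} (hg : Measurable g) :
    ∫⁻ x, g (forgetLast x) ∂(weight (d + 1) u) =
      ENNReal.ofReal (∫ t : ℝ, (1 + t ^ 2) ^ (-(((d : ℝ) + 1) * u / 2))) *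
        ∫⁻ y, g y ∂(weight d u') := by
  have hm1 : Measurable fun x : W (d + 1) => g (forgetLast x) :=
    hg.comp continuous_forgetLast.measurable
  rw [weight, weight, lintegral_withDensity_eq_lintegral_mul _ measurable_density hm1,
    lintegral_withDensity_eq_lintegral_mul _ measurable_density hg,
    lintegral_snoc (measurable_density.mul hm1),
    ← lintegral_const_mul _ (measurable_density.mul hg)]
  apply lintegral_congr_ae
  filter_upwards [ae_ne_zero] with y hy
  have hy' : 0 < ‖y‖ := norm_pos_iff.2 hy
  have hnorm : ∀ t : ℝ, ‖snocPt y t‖ ^ (-(((d + 1 : ℕ) : ℝ) * u)) =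
      (‖y‖ ^ 2 + t ^ 2) ^ (-(((d : ℝ) + 1) * u / 2)) := by
    intro t
    rw [← norm_snocPt_sq, ← Real.rpow_natCast, ← Real.rpow_mul (norm_nonneg _)]
    congr 1
    push_cast
    ring
  simp only [Pi.mul_apply, forgetLast_snocPt, hnorm]
  rw [lintegral_mul_const _ (by fun_prop), lintegral_extension_weight hu hy', ← mul_assoc,
    ← ENNReal.ofReal_mul (integral_extension_weight_pos hu).le, mul_comm (‖y‖ ^ _), hu']
  congr 4
  ring

/-- Makes composition with the projection well defined on almost-everywhere classes. -/
theorem quasiMeasurePreserving_forgetLast (hu : 1 < ((d : ℝ) + 1) * u)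
    (hu' : (d : ℝ) * u' = ((d : ℝ) + 1) * u - 1) :
    Measure.QuasiMeasurePreserving (forgetLast : W (d + 1) → W d) (weight (d + 1) u)
      (weight d u') := by
  refine ⟨continuous_forgetLast.measurable, Measure.AbsolutelyContinuous.mk fun s hs h0 => ?_⟩
  rw [Measure.map_apply continuous_forgetLast.measurable hs]
  have h := lintegral_comp_forgetLast hu hu' (g := s.indicator 1) (measurable_one.indicator hs)
  rw [lintegral_indicator_one hs, h0, mul_zero] at h
  have h2 : (fun x : W (d + 1) => s.indicator (1 : W d → ENNReal) (forgetLast x)) =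
      (forgetLast ⁻¹' s).indicator 1 := rfl
  rw [h2, lintegral_indicator_one (continuous_forgetLast.measurable hs)] at h
  exact h

theorem eLpNorm_comp_forgetLast (hu : 1 < ((d : ℝ) + 1) * u)
    (hu' : (d : ℝ) * u' = ((d : ℝ) + 1) * u - 1) {φ : W d → ℂ}
    (hφ : AEStronglyMeasurable φ (weight d u')) :
    eLpNorm (φ ∘ forgetLast) 2 (weight (d + 1) u) =
      ENNReal.ofReal (√(∫ t : ℝ, (1 + t ^ 2) ^ (-(((d : ℝ) + 1) * u / 2)))) *
        eLpNorm φ 2 (weight d u') := by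
  have hq := quasiMeasurePreserving_forgetLast hu hu'
  have hC := integral_extension_weight_pos hu
  obtain ⟨ψ, hψ, hφψ⟩ := hφ
  rw [eLpNorm_congr_ae hφψ, eLpNorm_congr_ae (hq.ae_eq hφψ),
    eLpNorm_eq_lintegral_rpow_enorm_toReal two_ne_zero ENNReal.ofNat_ne_top,
    eLpNorm_eq_lintegral_rpow_enorm_toReal two_ne_zero ENNReal.ofNat_ne_top]
  have h := lintegral_comp_forgetLast hu hu' (g := fun y => ‖ψ y‖ₑ ^ (2 : ENNReal).toReal)
    (by have := hψ.measurable; fun_prop)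
  simp only [Function.comp_apply]
  rw [h, ENNReal.mul_rpow_of_nonneg _ _ (by positivity),
    ENNReal.ofReal_rpow_of_pos hC, Real.sqrt_eq_rpow]
  simp

theorem memLp_comp_forgetLast (hu : 1 < ((d : ℝ) + 1) * u)
    (hu' : (d : ℝ) * u' = ((d : ℝ) + 1) * u - 1) {φ : W d → ℂ}
    (hφ : MemLp φ 2 (weight d u')) : MemLp (φ ∘ forgetLast) 2 (weight (d + 1) u) := by
  refine ⟨hφ.1.comp_quasiMeasurePreserving (quasiMeasurePreserving_forgetLast hu hu'), ?_⟩
  rw [eLpNorm_comp_forgetLast hu hu' hφ.1]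
  exact ENNReal.mul_lt_top ENNReal.ofReal_lt_top hφ.2

theorem exists_extension_isometry (hu : 1 < ((d : ℝ) + 1) * u)
    (hu' : (d : ℝ) * u' = ((d : ℝ) + 1) * u - 1) :
    ∃ J : WHat d u' →ₗᵢ[ℂ] WHat (d + 1) u, ∀ φ : WHat d u',
      (J φ : W (d + 1) → ℂ) =ᵐ[weight (d + 1) u] fun x =>
        (((√(∫ t : ℝ, (1 + t ^ 2) ^ (-(((d : ℝ) + 1) * u / 2))))⁻¹ : ℝ) : ℂ) *
          (φ : W d → ℂ) (forgetLast x) := by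
  have hq := quasiMeasurePreserving_forgetLast hu hu'
  have hC := integral_extension_weight_pos hu
  set C : ℝ := √(∫ t : ℝ, (1 + t ^ 2) ^ (-(((d : ℝ) + 1) * u / 2))) with hCdef
  have hC' : 0 < C := Real.sqrt_pos.2 hC
  have hmem : ∀ φ : WHat d u',
      MemLp (((C⁻¹ : ℝ) : ℂ) • ((φ : W d → ℂ) ∘ forgetLast)) 2 (weight (d + 1) u) :=
    fun φ => (memLp_comp_forgetLast hu hu' (Lp.memLp φ)).const_smul _
  let J₀ : WHat d u' →ₗ[ℂ] WHat (d + 1) u :=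
    { toFun := fun φ => (hmem φ).toLp _
      map_add' := fun φ ψ => by
        rw [← MemLp.toLp_add, MemLp.toLp_eq_toLp_iff]
        filter_upwards [hq.ae_eq (Lp.coeFn_add φ ψ)] with x hx
        simp only [Function.comp_apply, Pi.add_apply] at hx
        simp only [Pi.add_apply, Pi.smul_apply, Function.comp_apply, hx, smul_eq_mul, mul_add]
      map_smul' := fun c φ => by
        rw [RingHom.id_apply, ← MemLp.toLp_const_smul, MemLp.toLp_eq_toLp_iff]
        filter_upwards [hq.ae_eq (Lp.coeFn_smul c φ)] with x hx
        simp only [Function.comp_apply, Pi.smul_apply] at hx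
        simp only [Pi.smul_apply, Function.comp_apply, hx, smul_eq_mul, mul_left_comm] }
  refine ⟨⟨J₀, fun φ => ?_⟩, fun φ => MemLp.coeFn_toLp (hmem φ)⟩
  change ‖(hmem φ).toLp _‖ = _
  rw [Lp.norm_toLp, eLpNorm_const_smul, eLpNorm_comp_forgetLast hu hu' (Lp.aestronglyMeasurable φ),
    ← hCdef, ENNReal.toReal_mul, ENNReal.toReal_mul, ENNReal.toReal_ofReal hC'.le,
    ← mul_assoc, toReal_enorm, Complex.norm_real, Real.norm_of_nonneg (by positivity),
    inv_mul_cancel₀ hC'.ne', one_mul]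
  rfl

end ExtendConst

/-! ### Approximation by functions with compact support in the big cell -/

section Cutoff

open Filter Topology

variable {d : ℕ} [NeZero d] {u : ℝ}

theorem exists_cutoff (d : ℕ) : ∃ χ : ℕ → W d → ℝ, (∀ k, Continuous (χ k)) ∧
    (∀ k, HasCompactSupport (χ k)) ∧ (∀ k x, 0 ≤ χ k x ∧ χ k x ≤ 1) ∧
    ∀ x, ∀ᶠ k in atTop, χ k x = 1 := by
  refine ⟨fun k => (⟨(k : ℝ) + 1, (k : ℝ) + 2, by positivity, by linarith⟩ :
    ContDiffBump (0 : W d)), fun k => ContDiffBump.continuous _,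
    fun k => ContDiffBump.hasCompactSupport _,
    fun k x => ⟨ContDiffBump.nonneg _, ContDiffBump.le_one _⟩, fun x => ?_⟩
  obtain ⟨N, hN⟩ := exists_nat_ge ‖x‖
  filter_upwards [eventually_ge_atTop N] with k hk
  apply ContDiffBump.one_of_mem_closedBall
  rw [mem_closedBall_zero_iff]
  have : (N : ℝ) ≤ k := Nat.cast_le.2 hk
  change ‖x‖ ≤ (k : ℝ) + 1
  linarith

/-- Every element of the complementary series that comes from `F_u` is the limit of functions
with compact support in the big cell, also when paired with `F_{-u}`. -/
theorem exists_tendsto_compactSupport (hu : 0 < u) (hu1 : u < 1) {E : Type*}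
    [NormedAddCommGroup E] [InnerProductSpace ℂ E] (ι : F d u →ₗ[ℂ] E)
    (hι : ∀ f f' : F d u, ⟪ι f, ι f'⟫_ℂ = pairing f.1 (intertwine f'.1)) (φ : F d u) :
    ∃ ψ : ℕ → F d u, (∀ k, HasCompactSupport (bigCell (ψ k).1)) ∧
      Tendsto (fun k => ι (ψ k)) atTop (𝓝 (ι φ)) ∧
      ∀ f : F d (-u), Tendsto (fun k => pairing (ψ k).1 f.1) atTop (𝓝 (pairing φ.1 f.1)) := by
  have hd : (0 : ℝ) < d := Nat.cast_pos.2 (NeZero.pos d)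
  have hfin : (Module.finrank ℝ (W d) : ℝ) = d := by simp
  have h1u : 0 < 1 - u := by linarith
  obtain ⟨χ, hχc, hχs, hχ, hχ1⟩ := exists_cutoff d
  have hcont : ∀ k, Continuous fun x => (χ k x : ℂ) * bigCell φ.1 x := fun k =>
    (Complex.continuous_ofReal.comp (hχc k)).mul (continuous_bigCell φ.1.continuous)
  have hsupp : ∀ k, HasCompactSupport fun x => (χ k x : ℂ) * bigCell φ.1 x := fun k =>
    ((hχs k).comp_left (g := fun t : ℝ => (t : ℂ)) Complex.ofReal_zero).mul_right
  choose ψ hψ using fun k =>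
    exists_bigCell_eq_of_hasCompactSupport (u := u) (by linarith) (hcont k) (hsupp k)
  have hsub : ∀ k x, bigCell (ψ k - φ).1 x = ((χ k x : ℂ) - 1) * bigCell φ.1 x := by
    intro k x
    have h1 : bigCell (ψ k - φ).1 x = bigCell (ψ k).1 x - bigCell φ.1 x := rfl
    rw [h1, hψ]
    ring
  have hle : ∀ k x, ‖bigCell (ψ k - φ).1 x‖ ≤ ‖bigCell φ.1 x‖ := by
    intro k x
    rw [hsub, norm_mul]
    refine mul_le_of_le_one_left (norm_nonneg _) ?_
    rw [← Complex.ofReal_one, ← Complex.ofReal_sub, Complex.norm_real, Real.norm_eq_abs, abs_le]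
    constructor <;> linarith [hχ k x]
  have hev : ∀ x, ∀ᶠ k in atTop, bigCell (ψ k - φ).1 x = 0 := by
    intro x
    filter_upwards [hχ1 x] with k hk
    rw [hsub, hk]
    simp
  have hi := integrable_bigCell hu φ
  refine ⟨ψ, fun k => by rw [hψ]; exact hsupp k, ?_, fun f => ?_⟩
  · have hlim : Tendsto (fun k => ∫ p : W d × W d,
        ((‖p.1 - p.2‖ ^ (-((d : ℝ) * (1 - u))) : ℝ) : ℂ) *
        (conj (bigCell (ψ k - φ).1 p.1) * bigCell (ψ k - φ).1 p.2) ∂(volume.prod volume))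
        atTop (𝓝 (∫ p : W d × W d, (0 : ℂ) ∂(volume.prod volume))) := by
      refine tendsto_integral_of_dominated_convergence _ (fun k => ?_)
        (integrable_riesz_double hi hi (exists_bigCell_le (by linarith) φ)
          (l := d * (1 - u)) (by positivity) (by rw [hfin]; nlinarith))
        (fun k => Eventually.of_forall fun p => ?_) (Eventually.of_forall fun p => ?_)
      · have hc := continuous_bigCell (ψ k - φ).1.continuous
        exact (Measurable.aestronglyMeasurable (by fun_prop)).mul
          ((Complex.continuous_conj.comp (hc.comp continuous_fst)).mul
            (hc.comp continuous_snd)).aestronglyMeasurable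
      · rw [norm_mul, norm_mul, RCLike.norm_conj, Complex.norm_real,
          Real.norm_of_nonneg (by positivity)]
        gcongr
        · exact hle k _
        · exact hle k _
      · refine tendsto_const_nhds.congr' ?_
        filter_upwards [hev p.1] with k hk
        rw [hk]
        simp
    rw [integral_zero] at hlim
    have hlim2 := hlim.const_mul ((2 ^ ((d : ℝ) * (1 - u) / 2) : ℝ) : ℂ)
    simp_rw [← pairing_intertwine_eq_riesz hu hu1, ← hι] at hlim2
    rw [mul_zero] at hlim2
    have hlim3 := (continuous_norm.tendsto _).comp hlim2
    rw [norm_zero] at hlim3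
    have hlim4 := (Real.continuous_sqrt.tendsto _).comp hlim3
    rw [Real.sqrt_zero] at hlim4
    rw [tendsto_iff_norm_sub_tendsto_zero]
    refine hlim4.congr fun k => ?_
    have h1 : ι (ψ k - φ) = ι (ψ k) - ι φ := by
      rw [eq_sub_iff_add_eq, ← map_add]
      exact congrArg ι (Subtype.ext (sub_add_cancel (ψ k).1 φ.1))
    simp only [Function.comp_apply]
    rw [inner_self_eq_norm_sq_to_K, norm_pow, RCLike.norm_ofReal, abs_norm,
      Real.sqrt_sq (norm_nonneg _), h1]
  · refine tendsto_integral_of_dominated_convergence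
      (fun x => ‖conj (bigCell φ.1 x) * bigCell f.1 x‖) (fun k => ?_)
      (integrable_pairing hu hu1.le φ f).norm
      (fun k => Eventually.of_forall fun x => ?_) (Eventually.of_forall fun x => ?_)
    · exact (integrable_pairing hu hu1.le (ψ k) f).aestronglyMeasurable
    · rw [norm_mul, norm_mul, RCLike.norm_conj, RCLike.norm_conj]
      gcongr
      rw [hψ, norm_mul, Complex.norm_real, Real.norm_of_nonneg (hχ k x).1]
      exact mul_le_of_le_one_left (norm_nonneg _) (hχ k x).2
    · refine tendsto_const_nhds.congr' ?_
      filter_upwards [hχ1 x] with k hk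
      simp only [hψ, hk, Complex.ofReal_one, one_mul]

end Cutoff

/-! ### Product functions, dilations and dominated convergence in `L²` -/

section Thickening

open Filter Topology

variable {d : ℕ}

theorem snocPt_forgetLast (x : W (d + 1)) : snocPt (forgetLast x) (x (Fin.last d)) = x := by
  ext i
  exact congrFun (Fin.snoc_init_self (α := fun _ => ℝ) x.ofLp) i

theorem snocPt_last (y : W d) (t : ℝ) : snocPt y t (Fin.last d) = t := by
  simp [snocPt]

theorem inner_snocPt (y y' : W d) (t t' : ℝ) :
    ⟪snocPt y t, snocPt y' t'⟫_ℝ = ⟪y, y'⟫_ℝ + ⟪t, t'⟫_ℝ := by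
  simp [PiLp.inner_apply, Fin.sum_univ_castSucc, snocPt]

theorem continuous_snocPt : Continuous fun p : ℝ × W d => snocPt p.2 p.1 := by
  refine (PiLp.continuous_toLp 2 _).comp (continuous_pi fun i => ?_)
  refine Fin.lastCases ?_ (fun i => ?_) i
  · simp only [Fin.snoc_last]
    fun_prop
  · simp only [Fin.snoc_castSucc]
    fun_prop

theorem integral_snoc (f : W (d + 1) → ℂ) :
    ∫ x, f x = ∫ p : ℝ × W d, f (snocPt p.2 p.1) ∂(volume.prod volume) := by
  rw [← measurePreserving_snocEquiv.integral_comp (snocEquiv d).measurableEmbedding]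
  simp_rw [snocEquiv_apply]
  rfl

theorem fourier_mul_snoc (α : W d → ℂ) (β : ℝ → ℂ) (x : W (d + 1)) :
    𝓕 (fun z : W (d + 1) => α (forgetLast z) * β (z (Fin.last d))) x =
      𝓕 β (x (Fin.last d)) * 𝓕 α (forgetLast x) := by
  rw [Real.fourier_eq', Real.fourier_eq', Real.fourier_eq', integral_snoc, ← integral_prod_mul]
  congr 1
  ext p
  rw [← snocPt_forgetLast x, inner_snocPt]
  simp only [forgetLast_snocPt, snocPt_last, smul_eq_mul, mul_add, Complex.ofReal_add, add_mul,
    Complex.exp_add]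
  ring

theorem fourier_dilate {β : ℝ → ℂ} {r : ℝ} (hr : 0 < r) (τ : ℝ) :
    𝓕 (fun t => (r : ℂ) * β (r * t)) τ = 𝓕 β (r⁻¹ * τ) := by
  rw [Real.fourier_eq', Real.fourier_eq']
  have h := Measure.integral_comp_mul_left (fun t : ℝ =>
    Complex.exp ((↑(-2 * Real.pi * ⟪t, r⁻¹ * τ⟫_ℝ) * Complex.I)) • ((r : ℂ) * β t)) r
  rw [abs_of_pos (inv_pos.2 hr), ← integral_smul] at h
  convert! h using 2
  · ext t
    congr 5
    simp
    field_simp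
  · ext t
    have : (r : ℂ) ≠ 0 := Complex.ofReal_ne_zero.2 hr.ne'
    simp
    field_simp

/-- A mollifier on the line. -/
theorem exists_mollifier : ∃ β : ℝ → ℂ, Continuous β ∧ HasCompactSupport β ∧ ∫ t, β t = 1 := by
  let b : ContDiffBump (0 : ℝ) := ⟨1, 2, one_pos, one_lt_two⟩
  refine ⟨fun t => (b.normed volume t : ℂ), Complex.continuous_ofReal.comp b.continuous_normed,
    b.hasCompactSupport_normed.comp_left (g := fun t : ℝ => (t : ℂ)) Complex.ofReal_zero, ?_⟩
  rw [integral_complex_ofReal, b.integral_normed, Complex.ofReal_one]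

theorem tendsto_Lp_two_of_dominated {α : Type*} [MeasurableSpace α] {μ : Measure α}
    {f : ℕ → Lp ℂ 2 μ} {g : Lp ℂ 2 μ} {b : α → ℝ} (hb : MemLp b 2 μ)
    (hfb : ∀ k, ∀ᵐ x ∂μ, ‖f k x‖ ≤ b x)
    (hlim : ∀ᵐ x ∂μ, Tendsto (fun k => f k x) atTop (𝓝 (g x))) :
    Tendsto f atTop (𝓝 g) := by
  have hgb : ∀ᵐ x ∂μ, ‖g x‖ ≤ b x := by
    filter_upwards [hlim, ae_all_iff.2 hfb] with x hx hx'
    exact le_of_tendsto' hx.norm hx'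
  have h : Tendsto (fun k => ∫ x, ‖f k x - g x‖ ^ 2 ∂μ) atTop (𝓝 (∫ x, (0 : ℝ) ∂μ)) := by
    refine tendsto_integral_of_dominated_convergence (fun x => (2 * b x) ^ 2) (fun k => ?_)
      ((hb.const_mul 2).integrable_sq) (fun k => ?_) ?_
    · exact (((Lp.aestronglyMeasurable (f k)).sub (Lp.aestronglyMeasurable g)).norm.pow 2)
    · filter_upwards [hfb k, hgb] with x h1 h2
      rw [norm_pow, norm_norm]
      gcongr
      exact (norm_sub_le _ _).trans (by linarith)
    · filter_upwards [hlim] with x hx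
      simpa using ((hx.sub_const (g x)).norm.pow 2)
  rw [integral_zero] at h
  have h2 := (Real.continuous_sqrt.tendsto _).comp h
  rw [Real.sqrt_zero] at h2
  rw [tendsto_iff_norm_sub_tendsto_zero]
  refine h2.congr fun k => ?_
  have h3 : ‖f k - g‖ ^ 2 = ∫ x, ‖f k x - g x‖ ^ 2 ∂μ := by
    have h4 : (⟪f k - g, f k - g⟫_ℂ) = ((∫ x, ‖f k x - g x‖ ^ 2 ∂μ : ℝ) : ℂ) := by
      rw [L2.inner_def, ← integral_complex_ofReal]
      apply integral_congr_ae
      filter_upwards [Lp.coeFn_sub (f k) g] with x hx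
      rw [hx, inner_self_eq_norm_sq_to_K]
      simp
    rw [inner_self_eq_norm_sq_to_K, ← RCLike.ofReal_pow] at h4
    exact Complex.ofReal_injective h4
  simp only [Function.comp_apply]
  rw [← h3, Real.sqrt_sq (norm_nonneg _)]

end Thickening

/-! ### Restriction to the subgroup as pairing with `φ(y) δ(t)` -/

section Restriction

open Filter Topology

variable {d : ℕ} [NeZero d] {u u' : ℝ}

/-- The degrees agree: `d(1-u') = (d+1)(1-u)`. -/
theorem exists_restriction (hu' : (d : ℝ) * u' = ((d : ℝ) + 1) * u - 1) (f : F (d + 1) (-u)) :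
    ∃ f' : F d (-u'), (∀ h : SO d, f'.1 h = f.1 (embed h)) ∧
      ∀ y, bigCell f'.1 y = bigCell f.1 (snocPt y 0) := by
  have hhom : Homog ((d : ℝ) * (1 + -u') / 2) fun h : SO d => f.1 (embed h) := by
    intro g g' c h
    have h1 := homog_of_mem f _ _ c (col_embed_smul h)
    change f.1 (embed g) = _ * f.1 (embed g')
    rw [h1]
    congr 4
    push_cast
    linarith
  refine ⟨⟨⟨_, f.1.continuous.comp continuous_embed⟩, mem_F_of_homog _ hhom⟩, fun h => rfl,
    fun y => ?_⟩
  have h1 := homog_of_mem f _ _ 1 (col_embed_unip_weyl y)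
  rw [abs_one, Real.one_rpow, Complex.ofReal_one, one_mul] at h1
  exact h1

omit [NeZero d] in
theorem integral_dilate_fst {h : ℝ × W d → ℂ} {r : ℝ} (hr : 0 < r)
    (h1 : Integrable h (volume.prod volume))
    (h2 : Integrable (fun p : ℝ × W d => (r : ℂ) * h (r * p.1, p.2)) (volume.prod volume)) :
    ∫ p : ℝ × W d, (r : ℂ) * h (r * p.1, p.2) ∂(volume.prod volume) =
      ∫ p : ℝ × W d, h p ∂(volume.prod volume) := by
  rw [integral_prod_symm _ h1, integral_prod_symm _ h2]
  congr 1
  ext y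
  rw [integral_const_mul, Measure.integral_comp_mul_left (fun t => h (t, y)),
    abs_of_pos (inv_pos.2 hr), Complex.real_smul, ← mul_assoc, ← Complex.ofReal_mul,
    mul_inv_cancel₀ hr.ne', Complex.ofReal_one, one_mul]

/-- The functions `(y, t) ↦ φ(y) k β(k t)` approximate the distribution `φ(y) δ(t)`. -/
theorem exists_thickening (hu0 : 0 < u) (hu1 : u < 1) (hu'0 : 0 < u') (hu'1 : u' < 1)
    (hC : 1 < ((d : ℝ) + 1) * u) (hu' : (d : ℝ) * u' = ((d : ℝ) + 1) * u - 1)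
    {J : WHat d u' →ₗᵢ[ℂ] WHat (d + 1) u} {c₀ : ℝ} (hc₀ : c₀ ≠ 0) (hJ : ∀ φ : WHat d u',
      (J φ : W (d + 1) → ℂ) =ᵐ[weight (d + 1) u] fun x =>
        (c₀ : ℂ) * (φ : W d → ℂ) (forgetLast x))
    (φ : F d u') (hφ : HasCompactSupport (bigCell φ.1)) :
    ∃ f : ℕ → F (d + 1) u,
      Tendsto (fun k => fourierLp (d + 1) hu0 hu1 (f k)) atTop
        (𝓝 (((fourierConst (d + 1) u / (c₀ * fourierConst d u') : ℝ) : ℂ) •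
          J (fourierLp d hu'0 hu'1 φ))) ∧
      ∀ f' : F (d + 1) (-u), Tendsto (fun k => pairing (f k).1 f'.1) atTop
        (𝓝 (∫ y, conj (bigCell φ.1 y) * bigCell f'.1 (snocPt y 0))) := by
  obtain ⟨β, hβc, hβs, hβ1⟩ := exists_mollifier
  have hβi : Integrable β := hβc.integrable_of_hasCompactSupport hβs
  set r : ℕ → ℝ := fun k => (k : ℝ) + 1 with hr
  have hrpos : ∀ k, 0 < r k := fun k => by positivity
  have hrlim : Tendsto (fun k => (r k)⁻¹) atTop (𝓝 0) :=
    tendsto_inv_atTop_zero.comp (tendsto_atTop_add_const_right _ _ tendsto_natCast_atTop_atTop)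
  have hΦc := continuous_bigCell φ.1.continuous
  have hlast : Continuous fun z : W (d + 1) => z (Fin.last d) := by fun_prop
  have hdil : ∀ k, HasCompactSupport fun t : ℝ => (r k : ℂ) * β (r k * t) := fun k =>
    (hβs.comp_homeomorph (Homeomorph.mulLeft₀ (r k) (hrpos k).ne')).mul_left
  have hcont : ∀ k, Continuous fun z : W (d + 1) =>
      bigCell φ.1 (forgetLast z) * ((r k : ℂ) * β (r k * z (Fin.last d))) := fun k =>
    (hΦc.comp continuous_forgetLast).mul
      (continuous_const.mul (hβc.comp (continuous_const.mul hlast)))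
  have hsupp : ∀ k, HasCompactSupport fun z : W (d + 1) =>
      bigCell φ.1 (forgetLast z) * ((r k : ℂ) * β (r k * z (Fin.last d))) := by
    intro k
    refine HasCompactSupport.intro (K := (fun p : ℝ × W d => snocPt p.2 p.1) ''
      (tsupport (fun t : ℝ => (r k : ℂ) * β (r k * t)) ×ˢ tsupport (bigCell φ.1)))
      ((IsCompact.prod (hdil k) hφ).image continuous_snocPt) fun z hz => ?_
    by_contra hne
    refine hz ⟨(z (Fin.last d), forgetLast z), ⟨subset_tsupport _ ?_, subset_tsupport _ ?_⟩,
      snocPt_forgetLast z⟩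
    · exact right_ne_zero_of_mul hne
    · exact left_ne_zero_of_mul hne
  choose f hf using fun k =>
    exists_bigCell_eq_of_hasCompactSupport (u := u) (by linarith) (hcont k) (hsupp k)
  -- As `k` grows, `𝓕 β (t/r)` tends to `𝓕 β 0 = ∫ β = 1`, leaving a function constant in `t`; the
  -- bound by the `L¹` norm of `β` gives domination by the constant extension of `|𝓕 φ|`.
  have hfour : ∀ k x, 𝓕 (bigCell (f k).1) x =
      𝓕 β ((r k)⁻¹ * x (Fin.last d)) * 𝓕 (bigCell φ.1) (forgetLast x) := by
    intro k x
    rw [hf, fourier_mul_snoc (bigCell φ.1) fun t => (r k : ℂ) * β (r k * t),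
      fourier_dilate (hrpos k)]
  have hq := quasiMeasurePreserving_forgetLast hC hu'
  have hb := (fourierConst_pos (d := d) hu'0 hu'1).ne'
  refine ⟨f, ?_, fun f' => ?_⟩
  · have hmem := memLp_comp_forgetLast hC hu' (memLp_fourier hu'0 hu'1
      (integrable_bigCell hu'0 φ) (exists_bigCell_le (by linarith) φ))
    refine tendsto_Lp_two_of_dominated
      (hmem.norm.const_mul (fourierConst (d + 1) u * ∫ t, ‖β t‖)) (fun k => ?_) ?_
    · filter_upwards [coeFn_fourierLp hu0 hu1 (f k)] with x hx
      rw [hx, hfour, norm_mul, norm_mul, Complex.norm_real,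
        Real.norm_of_nonneg (fourierConst_pos hu0 hu1).le, mul_assoc]
      have h0 := (fourierConst_pos (d := d + 1) hu0 hu1).le
      refine mul_le_mul_of_nonneg_left ?_ h0
      exact mul_le_mul_of_nonneg_right (norm_fourier_le β _) (norm_nonneg _)
    · filter_upwards [ae_all_iff.2 fun k => coeFn_fourierLp hu0 hu1 (f k),
        hJ (fourierLp d hu'0 hu'1 φ), hq.ae_eq (coeFn_fourierLp hu'0 hu'1 φ),
        Lp.coeFn_smul ((fourierConst (d + 1) u / (c₀ * fourierConst d u') : ℝ) : ℂ)
          (J (fourierLp d hu'0 hu'1 φ))] with x h1 h2 h3 h4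
      simp only [Function.comp_apply] at h3
      rw [h4, Pi.smul_apply, h2, h3]
      simp_rw [h1, hfour]
      have h5 : Tendsto (fun k => 𝓕 β ((r k)⁻¹ * x (Fin.last d))) atTop (𝓝 1) := by
        have h6 := (continuous_fourier hβi).tendsto 0
        have h7 : 𝓕 β 0 = 1 := by
          rw [Real.fourier_eq', ← hβ1]
          congr 1
          ext t
          simp
        rw [h7] at h6
        refine h6.comp ?_
        simpa using hrlim.mul_const (x (Fin.last d))
      have h8 := (h5.mul_const (𝓕 (bigCell φ.1) (forgetLast x))).const_mul
        (fourierConst (d + 1) u : ℂ)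
      convert! h8 using 2
      have hb' : (fourierConst d u' : ℂ) ≠ 0 := Complex.ofReal_ne_zero.2 hb
      have hc' : (c₀ : ℂ) ≠ 0 := Complex.ofReal_ne_zero.2 hc₀
      rw [smul_eq_mul]
      push_cast
      field_simp
  · obtain ⟨M, hM⟩ := exists_bigCell_le (by linarith) f'
    have hF'c := continuous_bigCell f'.1.continuous
    have hΦi := integrable_bigCell hu'0 φ
    have hprod : Integrable (fun p : ℝ × W d => conj (β p.1) * conj (bigCell φ.1 p.2))
        (volume.prod volume) :=
      ((Complex.conjLIE.integrable_comp_iff).2 hβi).mul_prod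
        ((Complex.conjLIE.integrable_comp_iff).2 hΦi)
    have hprod' : ∀ k, Integrable (fun p : ℝ × W d =>
        conj ((r k : ℂ) * β (r k * p.1)) * conj (bigCell φ.1 p.2)) (volume.prod volume) := fun k =>
      ((Complex.conjLIE.integrable_comp_iff).2
        ((hβi.comp_mul_left' (hrpos k).ne').const_mul (r k : ℂ))).mul_prod
        ((Complex.conjLIE.integrable_comp_iff).2 hΦi)
    have hG : ∀ k, Continuous fun p : ℝ × W d =>
        bigCell f'.1 (snocPt p.2 ((r k)⁻¹ * p.1)) := fun k =>
      hF'c.comp (continuous_snocPt.comp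
        ((continuous_const.mul continuous_fst).prodMk continuous_snd))
    -- Substituting `t → t/r` moves the dilation from `β` to `f'`, so the integrands have a common
    -- majorant: `f'` is bounded on the big cell.
    have hpair : ∀ k, pairing (f k).1 f'.1 = ∫ p : ℝ × W d,
        conj (β p.1) * conj (bigCell φ.1 p.2) * bigCell f'.1 (snocPt p.2 ((r k)⁻¹ * p.1))
        ∂(volume.prod volume) := by
      intro k
      rw [pairing, integral_snoc, ← integral_dilate_fst (h := fun p : ℝ × W d =>
        conj (β p.1) * conj (bigCell φ.1 p.2) * bigCell f'.1 (snocPt p.2 ((r k)⁻¹ * p.1)))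
        (hrpos k)]
      · congr 1
        ext p
        rw [hf]
        simp only [forgetLast_snocPt, snocPt_last, map_mul, Complex.conj_ofReal,
          inv_mul_cancel_left₀ (hrpos k).ne']
        ring
      · exact hprod.mul_bdd (c := M) (hG k).aestronglyMeasurable
          (Eventually.of_forall fun p => hM _)
      · have h1 := (hprod' k).mul_bdd (c := M) (hF'c.comp continuous_snocPt).aestronglyMeasurable
          (Eventually.of_forall fun p => hM _)
        refine h1.congr (Eventually.of_forall fun p => ?_)
        simp only [Function.comp_apply, map_mul, Complex.conj_ofReal,
          inv_mul_cancel_left₀ (hrpos k).ne']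
        ring
    simp_rw [hpair]
    have hlim : ∫ y, conj (bigCell φ.1 y) * bigCell f'.1 (snocPt y 0) =
        ∫ p : ℝ × W d, conj (β p.1) * conj (bigCell φ.1 p.2) * bigCell f'.1 (snocPt p.2 0)
          ∂(volume.prod volume) := by
      have h1 := integral_prod_mul (μ := (volume : Measure ℝ)) (ν := (volume : Measure (W d)))
        (fun t => conj (β t)) (fun y => conj (bigCell φ.1 y) * bigCell f'.1 (snocPt y 0))
      rw [integral_conj, hβ1, map_one, one_mul] at h1
      rw [← h1]
      simp_rw [mul_assoc]
    rw [hlim]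
    refine tendsto_integral_of_dominated_convergence
      (fun p : ℝ × W d => ‖conj (β p.1) * conj (bigCell φ.1 p.2)‖ * M) (fun k => ?_)
      (hprod.norm.mul_const M) (fun k => Eventually.of_forall fun p => ?_)
      (Eventually.of_forall fun p => ?_)
    · exact hprod.aestronglyMeasurable.mul (hG k).aestronglyMeasurable
    · rw [norm_mul]
      exact mul_le_mul_of_nonneg_left (hM _) (norm_nonneg _)
    · refine Tendsto.const_mul _ ?_
      have h1 : Continuous fun t : ℝ => bigCell f'.1 (snocPt p.2 t) :=
        hF'c.comp (continuous_snocPt.comp (continuous_id.prodMk continuous_const))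
      refine (h1.tendsto 0).comp ?_
      simpa using hrlim.mul_const p.1

end Restriction

/-! ### The adjoint formula and equivariance -/

section Adjoint

open Filter Topology

variable {d : ℕ} [NeZero d] {u u' : ℝ}

/-- The adjoint of the embedding is, up to a constant, the restriction of functions. -/
theorem inner_extension {E E' : Type*} [NormedAddCommGroup E] [InnerProductSpace ℂ E]
    [NormedAddCommGroup E'] [InnerProductSpace ℂ E']
    (hu0 : 0 < u) (hu1 : u < 1) (hu'0 : 0 < u') (hu'1 : u' < 1)
    (hC : 1 < ((d : ℝ) + 1) * u) (hu' : (d : ℝ) * u' = ((d : ℝ) + 1) * u - 1)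
    {J : WHat d u' →ₗᵢ[ℂ] WHat (d + 1) u} {c₀ : ℝ} (hc₀ : c₀ ≠ 0) (hJ : ∀ φ : WHat d u',
      (J φ : W (d + 1) → ℂ) =ᵐ[weight (d + 1) u] fun x =>
        (c₀ : ℂ) * (φ : W d → ℂ) (forgetLast x))
    {ι : F (d + 1) u →ₗ[ℂ] E} {ι' : F d u' →ₗ[ℂ] E'}
    (hι' : ∀ f f' : F d u', ⟪ι' f, ι' f'⟫_ℂ = pairing f.1 (intertwine f'.1))
    {A : E ≃ₗᵢ[ℂ] WHat (d + 1) u} {B : E' ≃ₗᵢ[ℂ] WHat d u'}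
    (hA : ∀ f, A (ι f) = fourierLp (d + 1) hu0 hu1 f)
    (hB : ∀ f, B (ι' f) = fourierLp d hu'0 hu'1 f)
    {v : E} {f' : F (d + 1) (-u)} (hv : Represents ι v f') {k : F d (-u')}
    (hk : ∀ y, bigCell k.1 y = bigCell f'.1 (snocPt y 0)) (φ : F d u') :
    ⟪A.symm (J (B (ι' φ))), v⟫_ℂ =
      ((c₀ * fourierConst d u' / fourierConst (d + 1) u : ℝ) : ℂ) * pairing φ.1 k.1 := by
  have ha := (fourierConst_pos (d := d + 1) hu0 hu1).ne'
  have hb := (fourierConst_pos (d := d) hu'0 hu'1).ne'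
  set κ : ℝ := fourierConst (d + 1) u / (c₀ * fourierConst d u') with hκ
  have hinv : c₀ * fourierConst d u' / fourierConst (d + 1) u = κ⁻¹ := by rw [hκ, inv_div]
  have hκ0 : (κ : ℂ) ≠ 0 := Complex.ofReal_ne_zero.2 (div_ne_zero ha (mul_ne_zero hc₀ hb))
  -- For compactly supported `ψ` the thickenings converge to `κ` times the extension of `ψ` in `E`,
  -- while their pairings with `f'` converge to the pairing over `t = 0`.
  have hcompact : ∀ ψ : F d u', HasCompactSupport (bigCell ψ.1) →
      (κ : ℂ) * ⟪A.symm (J (B (ι' ψ))), v⟫_ℂ = pairing ψ.1 k.1 := by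
    intro ψ hψ
    obtain ⟨f, hf1, hf2⟩ := exists_thickening hu0 hu1 hu'0 hu'1 hC hu' hc₀ hJ ψ hψ
    have h1 : Tendsto (fun j => ι (f j)) atTop (𝓝 ((κ : ℂ) • A.symm (J (B (ι' ψ))))) := by
      have h2 := (A.symm.continuous.tendsto _).comp hf1
      rw [map_smul, ← hB] at h2
      refine h2.congr fun j => ?_
      rw [Function.comp_apply, ← hA, A.symm_apply_apply]
    have h3 : Tendsto (fun j => ⟪ι (f j), v⟫_ℂ) atTop (𝓝 _) := h1.inner tendsto_const_nhds
    have h5 := tendsto_nhds_unique (h3.congr fun j => hv (f j)) (hf2 f')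
    rw [inner_smul_left, Complex.conj_ofReal] at h5
    rw [h5, pairing]
    simp_rw [hk]
  -- Passing to general `φ` requires convergence in `E'` and of the pairings with `k` at once, since
  -- it is not known that `k` represents a vector.
  obtain ⟨ψ, hψs, hψ1, hψ2⟩ := exists_tendsto_compactSupport hu'0 hu'1 ι' hι' φ
  have hcont : Continuous fun z : E' => (κ : ℂ) * ⟪A.symm (J (B z)), v⟫_ℂ :=
    continuous_const.mul (((A.symm.continuous.comp (J.continuous.comp B.continuous))).inner
      continuous_const)
  have h6 := (hcont.tendsto _).comp hψ1
  have h7 := tendsto_nhds_unique (h6.congr fun j => hcompact (ψ j) (hψs j)) (hψ2 k)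
  rw [hinv, ← h7, Complex.ofReal_inv, inv_mul_cancel_left₀ hκ0]

theorem pairing_smul_right (c : ℂ) (f f' : SO d → ℂ) :
    pairing f (c • f') = c * pairing f f' := by
  rw [pairing, pairing, ← integral_const_mul]
  congr 1
  ext x
  simp only [bigCell, Pi.smul_apply, smul_eq_mul]
  ring

/-- A map under which restriction to the subgroup is adjoint, up to a constant, to inclusion
intertwines the two representations. -/
theorem equivariant_of_inner_eq {E E' : Type*} [NormedAddCommGroup E] [InnerProductSpace ℂ E]
    [CompleteSpace E] [NormedAddCommGroup E'] [InnerProductSpace ℂ E'] [CompleteSpace E']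
    (hu0 : 0 < u) (hu' : (d : ℝ) * u' = ((d : ℝ) + 1) * u - 1)
    {π : SO (d + 1) →* (E ≃ₗᵢ[ℂ] E)} {ι : F (d + 1) u →ₗ[ℂ] E}
    {σ : SO d →* (E' ≃ₗᵢ[ℂ] E')} {ι' : F d u' →ₗ[ℂ] E'}
    (hπ : IsComplementarySeries π ι) (hσ : IsComplementarySeries σ ι') {T : E' →ₗᵢ[ℂ] E} {c : ℂ}
    (hT : ∀ (v : E) (f' : F (d + 1) (-u)) (k : F d (-u')), Represents ι v f' →
      (∀ h, k.1 h = f'.1 (embed h)) → ∀ φ, ⟪T (ι' φ), v⟫_ℂ = c * pairing φ.1 k.1)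
    (h : SO d) (v : E') : T (σ h v) = π (embed h) (T v) := by
  have hιd : DenseRange ι := hπ.dense.mono (Set.image_subset_range _ _)
  have hι'd : DenseRange ι' := hσ.dense.mono (Set.image_subset_range _ _)
  -- It suffices to test against the dense vectors `ι f`, which are represented by `I_u f`; the
  -- adjoint formula applies to these.
  have hrep : ∀ f : F (d + 1) u, ∃ f' : F (d + 1) (-u), (∀ g, f'.1 g = intertwine f.1 g) ∧
      Represents ι (ι f) f' := by
    intro f
    obtain ⟨f', hf'⟩ := exists_intertwine hu0 f
    refine ⟨f', hf', fun φ => ?_⟩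
    rw [hπ.inner_eq, show intertwine f.1 = f'.1 from funext fun g => (hf' g).symm]
  have hcore : ∀ (φ : F d u') (f : F (d + 1) u),
      ⟪T (σ h (ι' φ)), ι f⟫_ℂ = ⟪π (embed h) (T (ι' φ)), ι f⟫_ℂ := by
    intro φ f
    have h1 : ι f = π (embed h) (ι (leftTranslate (embed h)⁻¹ f)) := by
      rw [hπ.map_translate, ← leftTranslate_mul, mul_inv_cancel, leftTranslate_one]
    have h2 : ⟪π (embed h) (T (ι' φ)), ι f⟫_ℂ =
        ⟪T (ι' φ), ι (leftTranslate (embed h)⁻¹ f)⟫_ℂ := by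
      conv_lhs => rw [h1]
      exact LinearIsometryEquiv.inner_map_map _ _ _
    obtain ⟨f₁, hf₁, hr₁⟩ := hrep f
    obtain ⟨f₂, hf₂, hr₂⟩ := hrep (leftTranslate (embed h)⁻¹ f)
    obtain ⟨k₁, hk₁, -⟩ := exists_restriction hu' f₁
    obtain ⟨k₂, hk₂, -⟩ := exists_restriction hu' f₂
    -- After moving `h` to the other side, both inner products are pairings over `H`. They agree by
    -- invariance of the pairing, because `I_u` commutes with translations and `embed` is
    -- multiplicative.
    rw [h2, hσ.map_translate, hT _ f₁ k₁ hr₁ hk₁, hT _ f₂ k₂ hr₂ hk₂,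
      ← pairing_mul_left (leftTranslate h φ) k₁ h]
    congr 2
    · ext x
      change φ.1 (h⁻¹ * (h * x)) = φ.1 x
      rw [inv_mul_cancel_left]
    · ext x
      rw [hk₁, hk₂, hf₁, hf₂, intertwine_leftTranslate, inv_inv, map_mul]
  refine hι'd.induction_on (p := fun v => T (σ h v) = π (embed h) (T v)) v
    (isClosed_eq (by fun_prop) (by fun_prop)) fun φ => ?_
  refine ext_inner_right ℂ fun w => ?_
  exact hιd.induction_on (p := fun w => ⟪T (σ h (ι' φ)), w⟫_ℂ = ⟪π (embed h) (T (ι' φ)), w⟫_ℂ) w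
    (isClosed_eq (by fun_prop) (by fun_prop)) fun f => hcore φ f

end Adjoint

end UnramifiedRestriction

/-! ### Assembly of the theorem -/

open UnramifiedRestriction in
/-- Here `n = d + 2`, so that `SO (d + 1)` is `G = SO(n, 1)` and `SO d` is `H = SO(n - 1, 1)`. -/
theorem mainTheorem4 (n d : ℕ) [NeZero d] (hn : n = d + 2) (u u' : ℝ)
    (hu : 1 / ((n : ℝ) - 1) < u) (hu1 : u < 1)
    (hu' : u' = (((n : ℝ) - 1) * u - 1) / ((n : ℝ) - 2)) :
    (0 < u' ∧ u' < 1) ∧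
    IntegralsConverge (d + 1) u ∧ IntegralsConverge d u' ∧
    -- the two complementary series exist
    (∃ (π : SO (d + 1) →* (WHat (d + 1) u ≃ₗᵢ[ℂ] WHat (d + 1) u))
      (ι : F (d + 1) u →ₗ[ℂ] WHat (d + 1) u), IsComplementarySeries π ι) ∧
    (∃ (σ : SO d →* (WHat d u' ≃ₗᵢ[ℂ] WHat d u'))
      (ι' : F d u' →ₗ[ℂ] WHat d u'), IsComplementarySeries σ ι') ∧
    ∃ a b c : ℝ, 0 < a ∧ 0 < b ∧ 0 < c ∧
      ∀ (E : Type*) [NormedAddCommGroup E] [InnerProductSpace ℂ E] [CompleteSpace E]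
        (E' : Type*) [NormedAddCommGroup E'] [InnerProductSpace ℂ E'] [CompleteSpace E']
        (π : SO (d + 1) →* (E ≃ₗᵢ[ℂ] E)) (ι : F (d + 1) u →ₗ[ℂ] E)
        (σ : SO d →* (E' ≃ₗᵢ[ℂ] E')) (ι' : F d u' →ₗ[ℂ] E'),
        IsComplementarySeries π ι → IsComplementarySeries σ ι' →
        ∃ (A : E ≃ₗᵢ[ℂ] WHat (d + 1) u) (B : E' ≃ₗᵢ[ℂ] WHat d u') (T : E' →ₗᵢ[ℂ] E),
          -- on the dense subspaces, `A` and `B` are the normalized Fourier transforms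
          (∀ f : F (d + 1) u, (A (ι f) : W (d + 1) → ℂ) =ᵐ[weight (d + 1) u]
            fun x => (a : ℂ) * 𝓕 (bigCell f.1) x) ∧
          (∀ f : F d u', (B (ι' f) : W d → ℂ) =ᵐ[weight d u']
            fun x => (b : ℂ) * 𝓕 (bigCell f.1) x) ∧
          -- the embedding is `H`-equivariant
          (∀ (h : SO d) (v : E'), T (σ h v) = π (embed h) (T v)) ∧
          -- on the Fourier side it is the normalized extension of functions
          (∀ v : E', (A (T v) : W (d + 1) → ℂ) =ᵐ[weight (d + 1) u] fun x =>
            (((√(∫ t : ℝ, (1 + t ^ 2) ^ (-(((n : ℝ) - 1) * u / 2))))⁻¹ : ℝ) : ℂ) *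
              (B v : W d → ℂ) (forgetLast x)) ∧
          -- its adjoint is, up to a constant, the restriction of functions from `G` to `H`
          (∀ f : F (d + 1) (-u), ∃ f' : F d (-u'), (∀ h : SO d, f'.1 h = f.1 (embed h)) ∧
            ∀ v : E, Represents ι v f →
              Represents ι' (ContinuousLinearMap.adjoint T.toContinuousLinearMap v)
                ((c : ℂ) • f')) := by
  have hd : (0 : ℝ) < d := Nat.cast_pos.2 (NeZero.pos d)
  have hn1 : (n : ℝ) - 1 = d + 1 := by rw [hn]; push_cast; ring
  have hn2 : (n : ℝ) - 2 = d := by rw [hn]; push_cast; ring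
  rw [hn1] at hu hu' ⊢
  rw [hn2] at hu'
  have hd1 : (0 : ℝ) < d + 1 := by positivity
  have hu0 : 0 < u := lt_trans (by positivity) hu
  have hC : 1 < ((d : ℝ) + 1) * u := by rwa [div_lt_iff₀' hd1] at hu
  have hdu : (d : ℝ) * u' = ((d : ℝ) + 1) * u - 1 := by rw [hu', mul_div_cancel₀ _ hd.ne']
  have hu'0 : 0 < u' := by rw [hu']; exact div_pos (by linarith) hd
  have hu'1 : u' < 1 := by rw [hu', div_lt_one hd]; nlinarith
  have hc₀ := inv_pos.2 (Real.sqrt_pos.2 (integral_extension_weight_pos hC))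
  obtain ⟨J, hJ⟩ := exists_extension_isometry hC hdu
  -- The constant `c` is `C^(-1/2) b / a`, as it appears in `inner_extension`; its value is fixed by
  -- the positivity proof.
  refine ⟨⟨hu'0, hu'1⟩, integralsConverge hu0 hu1.le, integralsConverge hu'0 hu'1.le,
    exists_complementarySeries hu0 hu1, exists_complementarySeries hu'0 hu'1,
    fourierConst (d + 1) u, fourierConst d u', _, fourierConst_pos hu0 hu1,
    fourierConst_pos hu'0 hu'1, div_pos (mul_pos hc₀ (fourierConst_pos (d := d) hu'0 hu'1))
      (fourierConst_pos (d := d + 1) hu0 hu1), ?_⟩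
  intro E _ _ _ E' _ _ _ π ι σ ι' hπ hσ
  obtain ⟨A, hA⟩ := exists_fourier_equiv hu0 hu1 hπ
  obtain ⟨B, hB⟩ := exists_fourier_equiv hu'0 hu'1 hσ
  have hinner {v : E} {f' : F (d + 1) (-u)} (hv : Represents ι v f') {k : F d (-u')} :=
    inner_extension hu0 hu1 hu'0 hu'1 hC hdu hc₀.ne' hJ hσ.inner_eq hA hB hv (k := k)
  refine ⟨A, B, A.symm.toLinearIsometry.comp (J.comp B.toLinearIsometry), fun f => ?_,
    fun f => ?_, ?_, fun v => ?_, fun f => ?_⟩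
  · rw [hA]
    exact coeFn_fourierLp hu0 hu1 f
  · rw [hB]
    exact coeFn_fourierLp hu'0 hu'1 f
  -- `inner_extension` asks only for the values on the big cell, which are read off from any
  -- restriction of `f'` to `H`.
  · refine equivariant_of_inner_eq hu0 hdu hπ hσ fun v f' k hv hk φ => hinner hv ?_ φ
    obtain ⟨k', hk', hk'1⟩ := exists_restriction hdu f'
    intro y
    rw [← hk'1, bigCell, bigCell, hk, hk']
  · convert! hJ (B v) using 1
    exact congrArg (fun w : WHat (d + 1) u => (w : W (d + 1) → ℂ))
      (A.apply_symm_apply (J (B v)))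
  · obtain ⟨k, hk, hk1⟩ := exists_restriction hdu f
    refine ⟨k, hk, fun v hv φ => ?_⟩
    rw [ContinuousLinearMap.adjoint_inner_right]
    exact (hinner hv hk1 φ).trans (pairing_smul_right _ φ.1 k.1).symm
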